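/- Conventions. "Computable in polynomial time" refers to Turing machines whose number of steps is bounded by a polynomial in the length of the binary input word; integers are output in binary, a number written in unary is the word $1^n$, and a pair $(n,k)\in\mathbb{N}\times\mathbb{Z}$ is input as $1^n\,0\,\mathrm{bin}(k)$, so that the time is polynomial in $n+\log|k|$. $\mathsf{FP}_1$ is the class of functions $\varphi:\mathbb{N}\to\mathbb{N}$ such that $1^n\mapsto\varphi(n)$ (in binary) is computable in polynomial time. $\#\mathsf{P}_1$ is the class of functions of the form $\varphi(n)=\#\{w\in\{0,1\}^*: |w|\le p(n),\ 1^n\,0\,w\in P\}$ with a polynomial $p$ and a language $P\in\mathsf{P}$. For $f\in L^2[0,1]$ (complex-valued), let $\tilde f_k=\int_0^1 e^{-2\pi i k t}f(t)\,dt$ for $k\in\mathbb{Z}$, and $\hat f_{S,s}=S\int_{s/S}^{(s+1)/S}f(t)\,dt$ for $0\le s<S$. Call $f$ \emph{Fourier-computable in polynomial time} if (i) there are Gaussian integers $c_{k,n}$ ($k\in\mathbb{Z}$, $n\in\mathbb{N}$) with $|\tilde f_k-c_{k,n}/2^n|\le 2^{-n}$ such that (ii) $(n,k)\mapsto\operatorname{Re}c_{k,n}$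 and $(n,k)\mapsto\operatorname{Im}c_{k,n}$ are computable in time polynomial in $n+\log|k|$, and (iii) there is a polynomial $p$ such that for all $m\in\mathbb{N}$, with $K=2^{p(m)}$, $\big\|f-\sum_{|k|\le K}\tilde f_k e^{2\pi i k t}\big\|_2\le 2^{-m}$. Theorem. There exists a function $f\in L^2[0,1]$ which is Fourier-computable in polynomial time, but such that, unless $\#\mathsf{P}_1\subseteq\mathsf{FP}_1$, its first step averages $\hat f_{S(n),0}$ with $S(n)=2^{n^2+n}$ are not computable in polynomial time: there is no sequence $(h_n)_{n\in\mathbb{N}}$ of Gaussian integers with $|\hat f_{S(n),0}-h_n/2^n|\le 2^{-n}$ for all $n$ for which $1^n\mapsto\operatorname{Re}h_n$ and $1^n\mapsto\operatorname{Im}h_n$ are computable in time polynomial in $n$. -/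

import Mathlib

open MeasureTheory

noncomputable section

namespace FourierStep

/-! ### Polynomial-time computation -/

/-- `F` is computable in time polynomial in the length of the encoded input, by a (multi-stack)
Turing machine in the sense of Mathlib. -/
def PolyTime {α β : Type} (ea : α → List Bool) (eb : β → List Bool) (F : α → β) : Prop :=
  Nonempty (Turing.TM2ComputableInPolyTime ea eb F)

/-- Binary encoding of an integer: a sign bit followed by the binary digits of `|z|`. -/
def encodeInt (z : ℤ) : List Bool :=
  decide (z < 0) :: Computability.encodeNat z.natAbs

/-- The word `1ⁿ 0 w`, pairing the number `n` (in unary) with the word `w`. -/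
def unaryPair (n : ℕ) (w : List Bool) : List Bool :=
  Computability.unaryEncodeNat n ++ false :: w

/-- The word `1ⁿ 0 bin(k)`, whose length is `n + log |k|` up to an additive constant. -/
def encodeNatInt (a : ℕ × ℤ) : List Bool :=
  unaryPair a.1 (encodeInt a.2)

/-- The class `P` of languages over `{0,1}` decidable in polynomial time. -/
def classP : Set (Set (List Bool)) :=
  {L | ∃ χ : List Bool → Bool, (∀ x, x ∈ L ↔ χ x = true) ∧ PolyTime id Computability.encodeBool χ}

/-- The class `FP₁`: functions computable in polynomial time, input in unary, output in binary. -/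
def classFP1 : Set (ℕ → ℕ) :=
  {φ | PolyTime Computability.unaryEncodeNat Computability.encodeNat φ}

/-- The class `#P₁`: functions counting, on unary input `1ⁿ`, the witnesses of length at most
polynomial in `n` accepted by a polynomial-time predicate. -/
def classSharpP1 : Set (ℕ → ℕ) :=
  {φ | ∃ P ∈ classP, ∃ p : Polynomial ℕ, ∀ n : ℕ,
    φ n = Set.ncard {w : List Bool | w.length ≤ p.eval n ∧ unaryPair n w ∈ P}}

/-! ### Square-integrable functions on the unit interval -/

/-- Lebesgue measure on `[0,1]`. -/
abbrev unitMeasure : Measure ℝ := volume.restrict (Set.Icc (0 : ℝ) 1)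

/-- The space `L²[0,1]` of complex-valued square-integrable functions. -/
abbrev L2Unit : Type := Lp ℂ 2 unitMeasure

/-- The `k`-th Fourier coefficient `∫₀¹ exp(-2πikt) f(t) dt`. -/
def fourierCoeff (f : L2Unit) (k : ℤ) : ℂ :=
  ∫ t, Complex.exp (-(2 * Real.pi * Complex.I * k * t)) * f t ∂unitMeasure

/-- The partial sum `∑_{|k| ≤ K} f̃ₖ exp(2πikt)` of the Fourier series. -/
def fourierPartialSum (f : L2Unit) (K : ℕ) (t : ℝ) : ℂ :=
  ∑ k ∈ Finset.Icc (-(K : ℤ)) K, fourierCoeff f k * Complex.exp (2 * Real.pi * Complex.I * k * t)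

/-- The average `S · ∫_{s/S}^{(s+1)/S} f(t) dt` of `f` over the `s`-th of `S` equal steps. -/
def stepAverage (f : L2Unit) (S s : ℕ) : ℂ :=
  S * ∫ t in ((s : ℝ) / S)..((s + 1 : ℝ) / S), f t

/-- `f ∈ L²[0,1]` is Fourier-computable in polynomial time. -/
def FourierPolyTime (f : L2Unit) : Prop :=
  (∃ c : ℤ → ℕ → GaussianInt,
    (∀ (k : ℤ) (n : ℕ), ‖fourierCoeff f k - (c k n : ℂ) / 2 ^ n‖ ≤ (2 ^ n : ℝ)⁻¹) ∧
    PolyTime encodeNatInt encodeInt (fun a : ℕ × ℤ => (c a.2 a.1).re) ∧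
    PolyTime encodeNatInt encodeInt (fun a : ℕ × ℤ => (c a.2 a.1).im)) ∧
  ∃ p : Polynomial ℕ, ∀ m : ℕ,
    eLpNorm (fun t => f t - fourierPartialSum f (2 ^ p.eval m) t) 2 unitMeasure
      ≤ ENNReal.ofReal (2 ^ m : ℝ)⁻¹

/-- The first step averages `f̂_{S(n),0}`, for the step counts `S(0), S(1), …`, are computable in
polynomial time: on input `1ⁿ` a Gaussian integer `hₙ` with `|f̂_{S(n),0} - hₙ/2ⁿ| ≤ 2⁻ⁿ` is
produced in time polynomial in `n`. Only precision `n` is asked for at step count `S(n)`, so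
that the negation of this property also excludes algorithms which approximate `f̂_{S(N),0}` to
every precision `2⁻ⁿ`, in time polynomial in `n + log S(N)` where `log S(N)` is polynomial. -/
def FirstStepPolyTime (f : L2Unit) (S : ℕ → ℕ) : Prop :=
  ∃ h : ℕ → GaussianInt,
    (∀ n : ℕ, ‖stepAverage f (S n) 0 - (h n : ℂ) / 2 ^ n‖ ≤ (2 ^ n : ℝ)⁻¹) ∧
    PolyTime Computability.unaryEncodeNat encodeInt (fun n => (h n).re) ∧
    PolyTime Computability.unaryEncodeNat encodeInt (fun n => (h n).im)

end FourierStep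

end

open MeasureTheory

/-!
The witness is a lacunary series. For every `m` and every word `w` from a finite set attached to `m`
it has the coefficient `2 ^ (-D m)` at the frequency with the binary digits `0ᴸ 1 1ᵐ 0 w 1`, where
`L = D m (D m + 1)`. A single coefficient is found by reading `m` and `w` off the digits of the
frequency and testing `w`, so the Fourier data is easy to compute. The average over the first of
`2 ^ (N² + N)` steps, for `N = D m + 1`, kills the frequencies belonging to numbers above `m`, as
they are divisible by `2 ^ (N² + N)`, whereas the other characters are almost equal to `1` there.
Hence this average is, up to `2 ^ (-N) / 2`, the sum of the coefficients belonging to `0, …, m`, and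
since `D` grows fast, the number of words attached to `m` can be read off from the last binary
digits of that sum. If `c` words are accepted for `m`, the `2 c + 1` words attached to `m` are the
empty word and the accepted words preceded by a bit: the odd number keeps the total error of `3/2`
units in the last place from causing a borrow or a carry.

Polynomial time bounds are proved for structured programs on stacks, which may call a given machine
and are themselves implemented by a machine.
-/

noncomputable section

namespace FourierStep

open Computability Turing StateTransition

/-! ### Binary words -/

theorem encodeNat_eq_bits (n : ℕ) : encodeNat n = n.bits := by
  induction n using Nat.binaryRec' with
  | zero => rfl
  | bit b n h ih =>
    rw [Nat.bits_append_bit n b h, ← ih, encodeNat, encodeNat, ← Num.ofNat'_eq, ← Num.ofNat'_eq,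
      Num.ofNat'_bit]
    rcases hn : Num.ofNat' n with _ | m
    · cases b
      · simp [show n = 0 by simpa [hn] using congrArg ((↑) : Num → ℕ) (Num.ofNat'_eq n).symm] at h
      · rfl
    · cases b <;> rfl

theorem encodeNat_two_pow (n : ℕ) : encodeNat (2 ^ n) = List.replicate n false ++ [true] := by
  rw [encodeNat_eq_bits]
  induction n with
  | zero => simp
  | succ n ih =>
    rw [pow_succ', Nat.bit0_bits _ (by positivity), ih]
    rfl

theorem length_encodeNat_le {n j : ℕ} (h : n < 2 ^ j) : (encodeNat n).length ≤ j := by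
  rw [encodeNat_eq_bits, Nat.size_eq_bits_len]
  exact Nat.size_le.2 h

/-- The number with given binary digits, least significant digit first. -/
def ofBits (l : List Bool) : ℕ := Nat.ofDigits 2 (l.map Bool.toNat)

theorem ofBits_append (l l' : List Bool) :
    ofBits (l ++ l') = ofBits l + 2 ^ l.length * ofBits l' := by
  simp [ofBits, Nat.ofDigits_append]

theorem toNat_lt_two_of_mem {l : List Bool} : ∀ d ∈ l.map Bool.toNat, d < 2 := fun d hd => by
  obtain ⟨b, -, rfl⟩ := List.mem_map.1 hd
  exact b.toNat_lt

theorem ofBits_lt (l : List Bool) : ofBits l < 2 ^ l.length := by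
  simpa [ofBits] using Nat.ofDigits_lt_base_pow_length one_lt_two (toNat_lt_two_of_mem (l := l))

theorem ofBits_drop (l : List Bool) (j : ℕ) : ofBits (l.drop j) = ofBits l / 2 ^ j := by
  rw [ofBits, ofBits, Nat.ofDigits_div_pow_eq_ofDigits_drop _ two_pos _ toNat_lt_two_of_mem,
    List.map_drop]

theorem ofBits_take (l : List Bool) (j : ℕ) : ofBits (l.take j) = ofBits l % 2 ^ j := by
  rw [ofBits, ofBits, Nat.ofDigits_mod_pow_eq_ofDigits_take _ two_pos _ toNat_lt_two_of_mem,
    List.map_take]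

theorem map_toNat_encodeNat (n : ℕ) : (encodeNat n).map Bool.toNat = Nat.digits 2 n := by
  rw [encodeNat_eq_bits, Nat.digits_two_eq_bits]
  rfl

theorem ofBits_encodeNat (n : ℕ) : ofBits (encodeNat n) = n := by
  rw [ofBits, map_toNat_encodeNat, Nat.ofDigits_digits]

theorem encodeNat_ofBits_append_true (l : List Bool) :
    encodeNat (ofBits (l ++ [true])) = l ++ [true] := by
  refine List.map_injective_iff.2 (by decide : Function.Injective Bool.toNat) ?_
  rw [map_toNat_encodeNat]
  exact Nat.digits_ofDigits 2 one_lt_two _ toNat_lt_two_of_mem (by simp)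

theorem encodeNat_ofBits (l : List Bool) :
    encodeNat (ofBits l) = (l.reverse.dropWhile (!·)).reverse := by
  induction l using List.reverseRecOn with
  | nil => rfl
  | append_singleton l b ih =>
    cases b with
    | false => simpa [ofBits_append, ofBits] using ih
    | true => simp [encodeNat_ofBits_append_true]

theorem encodeInt_two_pow (n : ℕ) :
    encodeInt (2 ^ n) = false :: (List.replicate n false ++ [true]) := by
  rw [encodeInt, Int.natAbs_pow, show Int.natAbs 2 = 2 from rfl, encodeNat_two_pow,
    decide_eq_false (not_lt.2 (by positivity))]

theorem unaryEncodeNat_eq (n : ℕ) : unaryEncodeNat n = List.replicate n true := by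
  induction n with
  | zero => rfl
  | succ n ih => rw [unaryEncodeNat, ih, List.replicate_succ]

/-- The number of bits `b` at the beginning of a word. -/
def runLength (b : Bool) (l : List Bool) : ℕ := (l.takeWhile (· == b)).length

/-- What follows, in a word `bⁿ (!b) l`, the initial run of the bit `b` and its terminator. -/
def afterRun (b : Bool) (l : List Bool) : List Bool := (l.dropWhile (· == b)).tail

theorem runLength_replicate_append {b c : Bool} (h : c ≠ b) (n : ℕ) (l : List Bool) :
    runLength b (List.replicate n b ++ c :: l) = n := by
  rw [runLength, List.takeWhile_append_of_pos (by simp), List.takeWhile_cons_of_neg (by simpa)]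
  simp

theorem afterRun_replicate_append {b c : Bool} (h : c ≠ b) (n : ℕ) (l : List Bool) :
    afterRun b (List.replicate n b ++ c :: l) = l := by
  rw [afterRun, List.dropWhile_append_of_pos (by simp), List.dropWhile_cons_of_neg (by simpa)]
  rfl

theorem takeWhile_eq_replicate_runLength (b : Bool) (l : List Bool) :
    l.takeWhile (· == b) = List.replicate (runLength b l) b :=
  List.eq_replicate_of_mem fun c hc => by simpa using List.mem_takeWhile_imp hc

theorem replicate_append_afterRun {b : Bool} {l : List Bool} (h : afterRun b l ≠ []) :
    List.replicate (runLength b l) b ++ (!b) :: afterRun b l = l := by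
  conv_rhs => rw [← List.takeWhile_append_dropWhile (p := (· == b)) (l := l)]
  rw [← takeWhile_eq_replicate_runLength]
  rw [afterRun] at h ⊢
  have hhead := List.head?_dropWhile_not (· == b) l
  generalize l.dropWhile (· == b) = l' at *
  cases l' with
  | nil => simp at h
  | cons c l' => cases b <;> cases c <;> simp_all

/-- The word `0ᶻ 1 1ᵐ 0 v`. -/
def blockCode (z m : ℕ) (v : List Bool) : List Bool :=
  List.replicate z false ++ true :: unaryPair m v

/-- The number `m` of a word `0ᶻ 1 1ᵐ 0 v`. -/
def codeIndex (l : List Bool) : ℕ := runLength true (afterRun false l)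

/-- The word `v` of a word `0ᶻ 1 1ᵐ 0 v`. -/
def codeWord (l : List Bool) : List Bool := afterRun true (afterRun false l)

theorem runLength_blockCode (z m : ℕ) (v : List Bool) : runLength false (blockCode z m v) = z :=
  runLength_replicate_append (c := true) (by decide) z _

theorem codeIndex_blockCode (z m : ℕ) (v : List Bool) : codeIndex (blockCode z m v) = m := by
  simp [codeIndex, blockCode, unaryPair, unaryEncodeNat_eq, runLength_replicate_append,
    afterRun_replicate_append]

theorem codeWord_blockCode (z m : ℕ) (v : List Bool) : codeWord (blockCode z m v) = v := by
  simp [codeWord, blockCode, unaryPair, unaryEncodeNat_eq, afterRun_replicate_append]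

theorem blockCode_of_codeWord_ne_nil {l : List Bool} (h : codeWord l ≠ []) :
    blockCode (runLength false l) (codeIndex l) (codeWord l) = l := by
  have hpair : unaryPair (codeIndex l) (codeWord l) = afterRun false l := by
    rw [unaryPair, unaryEncodeNat_eq]
    exact replicate_append_afterRun h
  rw [blockCode, hpair]
  exact replicate_append_afterRun fun h₀ => h (by rw [codeWord, h₀]; rfl)

/-! ### Stack programs calling a Turing machine -/

/-- Structured programs on stacks of bits indexed by `R`. `case r` pops a symbol from `r` and
branches on it. `loop r cont body` pops a symbol `b` from `r`, stopping if there is none, runs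
`body b`, and starts again if `cont b`. `call r r'` feeds the contents of `r`, bottom first, to a
fixed Turing machine and pushes its output onto `r'`. -/
inductive Prog (R : Type) : Type
  | skip
  | push (r : R) (b : Bool)
  | seq (p q : Prog R)
  | case (r : R) (body : Option Bool → Prog R)
  | loop (r : R) (cont : Bool → Bool) (body : Bool → Prog R)
  | call (r r' : R)

namespace Prog

variable {R : Type}

/-- The labels of the Turing machine fragment implementing a program, where `Λ` is the type of
labels of the called machine. -/
def Label (Λ : Type) : Prog R → Type
  | skip => Unit
  | push _ _ => Unit
  | seq p q => p.Label Λ ⊕ q.Label Λ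
  | case _ body => Option (Σ o, (body o).Label Λ)
  | loop _ _ body => Option (Σ b, (body b).Label Λ)
  | call _ _ => Bool ⊕ Λ

@[reducible]
def labelFintype (Λ : Type) [Fintype Λ] : (p : Prog R) → Fintype (p.Label Λ)
  | skip => inferInstanceAs (Fintype Unit)
  | push _ _ => inferInstanceAs (Fintype Unit)
  | seq p q =>
    haveI := labelFintype Λ p
    haveI := labelFintype Λ q
    inferInstanceAs (Fintype (p.Label Λ ⊕ q.Label Λ))
  | case _ body =>
    haveI := fun o => labelFintype Λ (body o)
    inferInstanceAs (Fintype (Option (Σ o, (body o).Label Λ)))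
  | loop _ _ body =>
    haveI := fun b => labelFintype Λ (body b)
    inferInstanceAs (Fintype (Option (Σ b, (body b).Label Λ)))
  | call _ _ => inferInstanceAs (Fintype (Bool ⊕ Λ))

/-- The label at which a program starts. -/
def entry (Λ : Type) : (p : Prog R) → p.Label Λ
  | skip => ()
  | push _ _ => ()
  | seq p _ => Sum.inl (p.entry Λ)
  | case _ _ => (none : Option _)
  | loop _ _ _ => (none : Option _)
  | call _ _ => Sum.inl false

variable (A : TM2ComputableAux Bool Bool)

/-- The stack alphabets of the implementing machine, which has the stacks of the called machine
and those of the program. -/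
abbrev Alphabet (R : Type) : A.tm.K ⊕ R → Type
  | Sum.inl k => A.tm.Γ k
  | Sum.inr _ => Bool

/-- The internal states of the implementing machine: a state of the called machine and a buffer
for the bit popped last. -/
abbrev State : Type := A.tm.σ × Option Bool

variable {A}

/-- Pop a symbol and continue according to the bit it stands for. -/
def popThen {T : Type} (k : A.tm.K ⊕ R) (d : Alphabet A R k → Bool)
    (g : Option Bool → TM2.Stmt (Alphabet A R) T (State A)) :
    TM2.Stmt (Alphabet A R) T (State A) :=
  .pop k (fun v o => (v.1, o.map d)) <|
    .branch (fun v => v.2 == none) (.load (fun v => (v.1, none)) (g none)) <|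
    .branch (fun v => v.2 == some true) (.load (fun v => (v.1, none)) (g (some true)))
      (.load (fun v => (v.1, none)) (g (some false)))

/-- A statement of the called machine as a statement of the implementing machine, which proceeds
to `e` instead of halting. -/
def liftStmt {T : Type} (j : A.tm.Λ → T) (e : T) :
    TM2.Stmt A.tm.Γ A.tm.Λ A.tm.σ → TM2.Stmt (Alphabet A R) T (State A)
  | .push k f q => .push (Sum.inl k) (fun v => f v.1) (liftStmt j e q)
  | .peek k f q => .peek (Sum.inl k) (fun v o => (f v.1 o, v.2)) (liftStmt j e q)
  | .pop k f q => .pop (Sum.inl k) (fun v o => (f v.1 o, v.2)) (liftStmt j e q)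
  | .load f q => .load (fun v => (f v.1, v.2)) (liftStmt j e q)
  | .branch f q q' => .branch (fun v => f v.1) (liftStmt j e q) (liftStmt j e q')
  | .goto f => .goto (fun v => j (f v.1))
  | .halt => .goto (fun _ => e)

variable (A)

/-- The statements at the labels of a program which is placed in a machine with labels `T` by `j`
and exits to `e`. -/
def code {T : Type} : (p : Prog R) → (p.Label A.tm.Λ → T) → T → p.Label A.tm.Λ →
    TM2.Stmt (Alphabet A R) T (State A)
  | skip, _, e, _ => .goto fun _ => e
  | push r b, _, e, _ => .push (Sum.inr r) (fun _ => b) (.goto fun _ => e)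
  | seq p q, j, e, l => Sum.casesOn l
      (fun l => p.code (fun l => j (Sum.inl l)) (j (Sum.inr (q.entry _))) l)
      (fun l => q.code (fun l => j (Sum.inr l)) e l)
  | case r body, j, e, l => Option.casesOn l
      (popThen (Sum.inr r) id fun o => .goto fun _ => j (some ⟨o, (body o).entry _⟩))
      (fun l => (body l.1).code (fun l' => j (some ⟨l.1, l'⟩)) e l.2)
  | loop r cont body, j, e, l => Option.casesOn l
      (popThen (Sum.inr r) id fun o => Option.casesOn o (.goto fun _ => e)
        (fun b => .goto fun _ => j (some ⟨b, (body b).entry _⟩)))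
      (fun l => (body l.1).code (fun l' => j (some ⟨l.1, l'⟩))
        (bif cont l.1 then j (none : Option _) else e) l.2)
  | call r r', j, e, l => Sum.casesOn l
      (fun b => Bool.casesOn b
        (popThen (Sum.inr r) id fun o => Option.casesOn o
          (.goto fun _ => j (Sum.inr A.tm.main))
          (fun b => .push (Sum.inl A.tm.k₀) (fun _ => A.inputAlphabet.symm b)
            (.goto fun _ => j (Sum.inl false))))
        (popThen (Sum.inl A.tm.k₁) A.outputAlphabet fun o => Option.casesOn o
          (.goto fun _ => e)
          (fun b => .push (Sum.inr r') (fun _ => b) (.goto fun _ => j (Sum.inl true)))))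
      (fun l => liftStmt (fun l => j (Sum.inr l)) (j (Sum.inl true)) (A.tm.m l))

/-- On input `x` the machine outputs `y` within `t` steps. -/
def Outputs (x y : List Bool) (t : ℕ) : Prop :=
  Nonempty (TM2OutputsInTime A.tm (x.map A.inputAlphabet.invFun)
    (some (y.map A.outputAlphabet.invFun)) t)

variable {A}

/-- The stacks of the implementing machine. -/
def join (M : ∀ k, List (A.tm.Γ k)) (s : R → List Bool) : ∀ k, List (Alphabet A R k)
  | Sum.inl k => M k
  | Sum.inr r => s r

variable (A) [DecidableEq R]

/-- `Run A p s s' t`: started on the stacks `s`, the program `p`, calling the machine `A`,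
terminates with the stacks `s'` after at most `t` steps. -/
inductive Run : Prog R → (R → List Bool) → (R → List Bool) → ℕ → Prop
  | skip (s) : Run skip s s 1
  | push (r b s) : Run (push r b) s (Function.update s r (b :: s r)) 1
  | seq {p q s s' s'' t t'} : Run p s s' t → Run q s' s'' t' → Run (seq p q) s s'' (t + t')
  | case {r body s s' t} :
      Run (body (s r).head?) (Function.update s r (s r).tail) s' t →
      Run (case r body) s s' (t + 1)
  | loop_nil {r cont body s} : s r = [] → Run (loop r cont body) s s 1
  | loop_exit {r cont body s s' t b l} : s r = b :: l → cont b = false →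
      Run (body b) (Function.update s r l) s' t → Run (loop r cont body) s s' (t + 1)
  | loop_cont {r cont body s s' s'' t t' b l} : s r = b :: l → cont b = true →
      Run (body b) (Function.update s r l) s' t → Run (loop r cont body) s' s'' t' →
      Run (loop r cont body) s s'' (t + 1 + t')
  | call {r r' s x y t} : r ≠ r' → s r = x.reverse → Outputs A x y t →
      Run (call r r') s (Function.update (Function.update s r []) r' (y.reverse ++ s r'))
        (x.length + 1 + t + (y.length + 1))
  | mono {p s s' t u} : Run p s s' t → t ≤ u → Run p s s' u

variable {A}

/-! ### Correctness of the implementation -/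

/-- `b` is reached from `a` in at most `n` steps. -/
def ReachesIn {σ : Type} (f : σ → Option σ) (a b : σ) (n : ℕ) : Prop :=
  Nonempty (EvalsToInTime f a (some b) n)

theorem ReachesIn.trans {σ : Type} {f : σ → Option σ} {a b c : σ} {n m : ℕ}
    (h : ReachesIn f a b n) (h' : ReachesIn f b c m) : ReachesIn f a c (n + m) := by
  obtain ⟨h⟩ := h
  obtain ⟨h'⟩ := h'
  exact ⟨add_comm m n ▸ EvalsToInTime.trans f n m a b _ h h'⟩

theorem ReachesIn.mono {σ : Type} {f : σ → Option σ} {a b : σ} {n m : ℕ}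
    (h : ReachesIn f a b n) (hm : n ≤ m) : ReachesIn f a b m :=
  h.map fun e => ⟨e.toEvalsTo, e.steps_le_m.trans hm⟩

theorem ReachesIn.single {σ : Type} {f : σ → Option σ} {a b : σ} (h : f a = some b) :
    ReachesIn f a b 1 :=
  ⟨⟨⟨1, by simpa [flip] using h⟩, le_rfl⟩⟩

theorem ReachesIn.head {σ : Type} {f : σ → Option σ} {a b c : σ} {n : ℕ} (h : f a = some b)
    (h' : ReachesIn f b c n) : ReachesIn f a c (n + 1) :=
  add_comm 1 n ▸ (ReachesIn.single h).trans h'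

theorem update_join_inr (M : ∀ k, List (A.tm.Γ k)) (s : R → List Bool) (r : R) (l : List Bool) :
    Function.update (join M s) (Sum.inr r) l = join M (Function.update s r l) := by
  funext k
  rcases k with k | k
  · simp [join]
  · by_cases h : k = r
    · subst h; simp [join]
    · simp [join, h]

theorem update_join_inl (M : ∀ k, List (A.tm.Γ k)) (s : R → List Bool) (k : A.tm.K)
    (l : List (A.tm.Γ k)) :
    Function.update (join M s) (Sum.inl k) l = join (Function.update M k l) s := by
  funext k'
  rcases k' with k' | k'
  · by_cases h : k' = k
    · subst h; simp [join]
    · simp [join, h]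
  · simp [join]

theorem stepAux_popThen {T : Type} (k : A.tm.K ⊕ R) (d : Alphabet A R k → Bool)
    (g : Option Bool → TM2.Stmt (Alphabet A R) T (State A)) (v : A.tm.σ)
    (S : ∀ k, List (Alphabet A R k)) :
    TM2.stepAux (popThen k d g) (v, none) S =
      TM2.stepAux (g ((S k).head?.map d)) (v, none) (Function.update S k (S k).tail) := by
  rcases h : (S k).head?.map d with _ | b
  · simp [popThen, h]
  · cases b <;> simp [popThen, h]

theorem stepAux_liftStmt {T : Type} (j : A.tm.Λ → T) (e : T) (s : R → List Bool)
    (q : TM2.Stmt A.tm.Γ A.tm.Λ A.tm.σ) (v : A.tm.σ) (M : ∀ k, List (A.tm.Γ k)) :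
    TM2.stepAux (liftStmt j e q) (v, none) (join M s) =
      (let c := TM2.stepAux q v M
       ⟨some ((c.l.map j).getD e), (c.var, none), join c.stk s⟩ :
        TM2.Cfg (Alphabet A R) T (State A)) := by
  induction q generalizing v M with
  | push k f q ih => simp only [liftStmt, TM2.stepAux, update_join_inl, ← ih]; rfl
  | peek k f q ih => simp only [liftStmt, TM2.stepAux, ← ih]; rfl
  | pop k f q ih => simp only [liftStmt, TM2.stepAux, update_join_inl, ← ih]; rfl
  | load f q ih => simp only [liftStmt, TM2.stepAux, ← ih]
  | branch f q q' ih ih' =>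
    simp only [liftStmt, TM2.stepAux]
    cases f v
    · simpa using ih' v M
    · simpa using ih v M
  | goto f => simp [liftStmt]
  | halt => simp [liftStmt]

theorem initList_stk (tm : FinTM2) (x : List (tm.Γ tm.k₀)) :
    (initList tm x).stk = Function.update (fun _ => []) tm.k₀ x := by
  funext k
  by_cases h : k = tm.k₀
  · subst h; simp [initList]
  · simp [initList, h]

theorem haltList_stk (tm : FinTM2) (x : List (tm.Γ tm.k₁)) :
    (haltList tm x).stk = Function.update (fun _ => []) tm.k₁ x := by
  funext k
  by_cases h : k = tm.k₁
  · subst h; simp [haltList]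
  · simp [haltList, h]

/-- The configuration at label `l` in which the called machine is in its initial state with stacks
`M`, and the stacks of the program are `s`. -/
def cfg {T : Type} (l : T) (M : ∀ k, List (A.tm.Γ k)) (s : R → List Bool) :
    TM2.Cfg (Alphabet A R) T (State A) :=
  ⟨some l, (A.tm.initialState, none), join M s⟩

section Implementation

variable {T : Type} {m : T → TM2.Stmt (Alphabet A R) T (State A)} {r r' : R}

theorem step_cfg {l : T} {q : TM2.Stmt (Alphabet A R) T (State A)} (h : m l = q)
    (M : ∀ k, List (A.tm.Γ k)) (s : R → List Bool) :
    TM2.step m (cfg l M s) = some (TM2.stepAux q (A.tm.initialState, none) (join M s)) := by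
  rw [cfg, TM2.step, h]

theorem step_case {body : Option Bool → Prog R} {j : (case r body).Label A.tm.Λ → T} {e : T}
    (hm : ∀ l, m (j l) = code A (case r body) j e l) (M : ∀ k, List (A.tm.Γ k))
    (s : R → List Bool) :
    TM2.step m (cfg (j ((case r body).entry _)) M s) =
      some (cfg (j (some ⟨(s r).head?, (body (s r).head?).entry _⟩)) M
        (Function.update s r (s r).tail)) := by
  refine (step_cfg (hm (none : Option _)) _ _).trans ?_
  simp only [code, stepAux_popThen, update_join_inr, cfg, join, TM2.stepAux, Option.some.injEq,
    TM2.Cfg.mk.injEq, and_true]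
  cases (s r).head? <;> rfl

section Loop

variable {cont : Bool → Bool} {body : Bool → Prog R} {j : (loop r cont body).Label A.tm.Λ → T}
  {e : T}

theorem step_loop_nil (hm : ∀ l, m (j l) = code A (loop r cont body) j e l)
    (M : ∀ k, List (A.tm.Γ k)) {s : R → List Bool} (hs : s r = []) :
    TM2.step m (cfg (j ((loop r cont body).entry _)) M s) = some (cfg e M s) := by
  refine (step_cfg (hm (none : Option _)) _ _).trans ?_
  have hu : Function.update s r [] = s := Function.update_eq_self_iff.2 hs.symm
  simp only [code, stepAux_popThen, update_join_inr, cfg]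
  simp [join, hs, hu]

theorem step_loop_cons (hm : ∀ l, m (j l) = code A (loop r cont body) j e l)
    (M : ∀ k, List (A.tm.Γ k)) {s : R → List Bool} {b : Bool} {l : List Bool} (hs : s r = b :: l) :
    TM2.step m (cfg (j ((loop r cont body).entry _)) M s) =
      some (cfg (j (some ⟨b, (body b).entry _⟩)) M (Function.update s r l)) := by
  refine (step_cfg (hm (none : Option _)) _ _).trans ?_
  simp only [code, stepAux_popThen, update_join_inr, cfg]
  simp [join, hs]

end Loop

section Call

variable {j : (call r r').Label A.tm.Λ → T} {e : T}

theorem reachesIn_load (hm : ∀ l, m (j l) = code A (call r r') j e l) (l : List Bool)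
    (s : R → List Bool) (c : List (A.tm.Γ A.tm.k₀)) (hs : s r = l) :
    ReachesIn (TM2.step m)
      (cfg (j (Sum.inl false)) (Function.update (fun _ => []) A.tm.k₀ c) s)
      (cfg (j (Sum.inr A.tm.main))
        (Function.update (fun _ => []) A.tm.k₀ (l.reverse.map A.inputAlphabet.symm ++ c))
        (Function.update s r [])) (l.length + 1) := by
  induction l generalizing s c with
  | nil =>
    refine .single ((step_cfg (hm (Sum.inl false)) _ _).trans ?_)
    simp only [code, stepAux_popThen, update_join_inr, cfg]
    simp [join, hs]
  | cons b l ih =>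
    have h := ih (Function.update s r l) (A.inputAlphabet.symm b :: c) (by simp)
    rw [Function.update_idem] at h
    refine .head ((step_cfg (hm (Sum.inl false)) _ _).trans ?_) (by simpa using h)
    simp only [code, stepAux_popThen, update_join_inr, cfg]
    simp [join, hs, update_join_inl]

theorem reachesIn_unload (hm : ∀ l, m (j l) = code A (call r r') j e l) (l : List Bool)
    (s : R → List Bool) :
    ReachesIn (TM2.step m)
      (cfg (j (Sum.inl true)) (Function.update (fun _ => []) A.tm.k₁
        (l.map A.outputAlphabet.symm)) s)
      (cfg e (fun _ => []) (Function.update s r' (l.reverse ++ s r'))) (l.length + 1) := by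
  induction l generalizing s with
  | nil =>
    refine .single ((step_cfg (hm (Sum.inl true)) _ _).trans ?_)
    simp only [code, stepAux_popThen, update_join_inl, cfg]
    simp [join]
  | cons b l ih =>
    have h := ih (Function.update s r' (b :: s r'))
    rw [Function.update_idem] at h
    refine .head ((step_cfg (hm (Sum.inl true)) _ _).trans ?_) (by simpa using h)
    simp only [code, stepAux_popThen, update_join_inl, cfg]
    simp [join, update_join_inr]

/-- The configuration of the implementing machine during a call, when the called machine is in
configuration `c`; once the latter halts, its output is unloaded. -/
def callCfg (j : (call r r').Label A.tm.Λ → T) (s : R → List Bool) (c : A.tm.Cfg) :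
    TM2.Cfg (Alphabet A R) T (State A) :=
  ⟨some ((c.l.map fun l => j (Sum.inr l)).getD (j (Sum.inl true))), (c.var, none), join c.stk s⟩

theorem step_callCfg (hm : ∀ l, m (j l) = code A (call r r') j e l) (s : R → List Bool)
    {c d : A.tm.Cfg} (h : A.tm.step c = some d) :
    TM2.step m (callCfg j s c) = some (callCfg j s d) := by
  obtain ⟨_ | l, v, S⟩ := c
  · cases h
  · have hl : m (j (Sum.inr l)) =
        liftStmt (fun l => j (Sum.inr l)) (j (Sum.inl true)) (A.tm.m l) := hm (Sum.inr l)
    cases h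
    simp only [callCfg, Option.map_some, Option.getD_some, TM2.step, hl, stepAux_liftStmt]

theorem reachesIn_callCfg (hm : ∀ l, m (j l) = code A (call r r') j e l) (s : R → List Bool)
    {n : ℕ} {c d : A.tm.Cfg} (h : ReachesIn A.tm.step c d n) :
    ReachesIn (TM2.step m) (callCfg j s c) (callCfg j s d) n := by
  obtain ⟨⟨⟨i, hi⟩, hin⟩⟩ := h
  refine ⟨⟨⟨i, ?_⟩, hin⟩⟩
  clear hin
  induction i generalizing d with
  | zero =>
    cases hi
    rfl
  | succ i ih =>
    rw [Function.iterate_succ_apply'] at hi ⊢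
    obtain ⟨c', hc', hd⟩ := Option.bind_eq_some_iff.1 hi
    rw [ih hc']
    exact step_callCfg hm s hd

theorem reachesIn_call (hm : ∀ l, m (j l) = code A (call r r') j e l) {s : R → List Bool}
    {x y : List Bool} {t : ℕ} (hr : r ≠ r') (hs : s r = x.reverse) (ho : Outputs A x y t) :
    ReachesIn (TM2.step m) (cfg (j ((call r r').entry _)) (fun _ => []) s)
      (cfg e (fun _ => []) (Function.update (Function.update s r []) r' (y.reverse ++ s r')))
      (x.length + 1 + t + (y.length + 1)) := by
  have hload := reachesIn_load hm x.reverse s [] hs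
  have hcall := reachesIn_callCfg hm (Function.update s r []) ho
  have hunload := reachesIn_unload hm y (Function.update s r [])
  rw [Function.update_eq_self_iff.2 rfl, List.length_reverse, List.reverse_reverse,
    List.append_nil] at hload
  rw [Function.update_of_ne hr.symm] at hunload
  rw [callCfg, callCfg, initList_stk, haltList_stk] at hcall
  exact (hload.trans hcall).trans hunload

end Call

theorem Run.reachesIn {p : Prog R} {s s' : R → List Bool} {t : ℕ} (h : Run A p s s' t)
    {j : p.Label A.tm.Λ → T} {e : T} (hm : ∀ l, m (j l) = code A p j e l) :
    ReachesIn (TM2.step m) (cfg (j (p.entry _)) (fun _ => []) s) (cfg e (fun _ => []) s') t := by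
  induction h generalizing e with
  | skip s => exact .single (by simp [cfg, hm, code])
  | push r b s => exact .single (by simp [cfg, hm, code, update_join_inr, join])
  | @seq p q s s' s'' t t' _ _ ih ih' =>
    exact (ih (j := fun l => j (Sum.inl l)) (e := j (Sum.inr (q.entry _)))
      fun l => hm (Sum.inl l)).trans (ih' (j := fun l => j (Sum.inr l)) fun l => hm (Sum.inr l))
  | @case r body s s' t _ ih =>
    exact .head (step_case hm _ _)
      (ih (j := fun l => j (some ⟨_, l⟩)) (fun l => hm (some ⟨_, l⟩)))
  | loop_nil hs => exact .single (step_loop_nil hm _ hs)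
  | @loop_exit r cont body s s' t b l hs hb _ ih =>
    refine .head (step_loop_cons hm _ hs)
      (ih (j := fun l => j (some ⟨_, l⟩)) fun l => (hm (some ⟨_, l⟩)).trans ?_)
    simp [code, hb]
  | @loop_cont r cont body s s' s'' t t' b l hs hb _ _ ih ih' =>
    refine (ReachesIn.head (step_loop_cons hm _ hs) (ih (j := fun l => j (some ⟨_, l⟩))
      (e := j (none : Option _)) fun l => (hm (some ⟨_, l⟩)).trans ?_)).trans (ih' hm)
    simp [code, hb]
  | call hr hs ho => exact reachesIn_call hm hr hs ho
  | mono _ ht ih => exact (ih hm).mono ht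

end Implementation

/-- The machine which executes a program, with input stack `r` and output stack `r'`. -/
def machine [Fintype R] (A : TM2ComputableAux Bool Bool) (p : Prog R) (r r' : R) : FinTM2 :=
  letI := A.tm.kFin
  letI := A.tm.ΛFin
  letI := A.tm.σFin
  letI := labelFintype A.tm.Λ p
  { K := A.tm.K ⊕ R
    k₀ := Sum.inr r
    k₁ := Sum.inr r'
    Γ := Alphabet A R
    Λ := Option (p.Label A.tm.Λ)
    main := some (p.entry _)
    σ := State A
    initialState := (A.tm.initialState, none)
    Γk₀Fin := inferInstanceAs (Fintype Bool)
    m := fun l => Option.casesOn l .halt (fun l => code A p some none l) }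

theorem update_nil_inr (r : R) (l : List Bool) :
    (Function.update (fun _ => []) (Sum.inr r) l : ∀ k, List (Alphabet A R k)) =
      join (fun _ => []) (Function.update (fun _ => []) r l) := by
  rw [← update_join_inr]
  congr 1
  funext k
  cases k <;> rfl

theorem initList_machine [Fintype R] (p : Prog R) (r r' : R) (x : List Bool) :
    initList (machine A p r r') x =
      cfg (some (p.entry _)) (fun _ => []) (Function.update (fun _ => []) r x) :=
  congrArg (TM2.Cfg.mk (some (some (p.entry _))) (A.tm.initialState, none))
    ((initList_stk (machine A p r r') x).trans (update_nil_inr r x))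

theorem haltList_machine [Fintype R] (p : Prog R) (r r' : R) (y : List Bool) :
    haltList (machine A p r r') y = ⟨none, (A.tm.initialState, none),
      join (fun _ => []) (Function.update (fun _ => []) r' y)⟩ :=
  congrArg (TM2.Cfg.mk none (A.tm.initialState, none))
    ((haltList_stk (machine A p r r') y).trans (update_nil_inr r' y))

theorem Run.outputs_machine [Fintype R] {p : Prog R} {r r' : R} {x y : List Bool} {t : ℕ}
    (h : Run A p (Function.update (fun _ => []) r x) (Function.update (fun _ => []) r' y) t) :
    Outputs ⟨machine A p r r', Equiv.refl Bool, Equiv.refl Bool⟩ x y (t + 1) := by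
  have hrun := h.reachesIn (m := (machine A p r r').m) (j := some) (e := none) fun _ => rfl
  have hhalt : (machine A p r r').step (cfg none (fun _ => [])
      (Function.update (fun _ => []) r' y)) = some (haltList (machine A p r r') y) :=
    congrArg some (haltList_machine p r r' y).symm
  have hreach : ReachesIn (machine A p r r').step (initList (machine A p r r') x)
      (haltList (machine A p r r') y) (t + 1) := by
    rw [initList_machine]
    exact hrun.trans (.single hhalt)
  have hid (l : List Bool) : l.map (Equiv.refl Bool).invFun = l := List.map_id l
  rwa [← hid x, ← hid y] at hreach

theorem polyTime_of_run [Finite R] {α β : Type} {ea : α → List Bool} {eb : β → List Bool}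
    {F : α → β} (p : Prog R) (r r' : R) (P : Polynomial ℕ)
    (h : ∀ a, Run A p (Function.update (fun _ => []) r (ea a))
      (Function.update (fun _ => []) r' (eb (F a))) (P.eval (ea a).length)) :
    PolyTime ea eb F :=
  letI := Fintype.ofFinite R
  ⟨⟨⟨machine A p r r', Equiv.refl Bool, Equiv.refl Bool⟩, P + 1, fun a => Classical.choice <| by
    rw [Polynomial.eval_add, Polynomial.eval_one]
    exact (h a).outputs_machine⟩⟩

end Prog

/-! ### Polynomially bounded running time -/

/-- `f` is bounded by a polynomial in the size `sz` of the instance. -/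
def PolyBounded {ι : Type} (sz f : ι → ℕ) : Prop :=
  ∃ P : Polynomial ℕ, ∀ a, f a ≤ P.eval (sz a)

theorem eval_mono (P : Polynomial ℕ) : Monotone fun n => P.eval n := by
  intro m n h
  simp only [Polynomial.eval_eq_sum]
  exact Finset.sum_le_sum fun i _ => Nat.mul_le_mul_left _ (Nat.pow_le_pow_left h i)

namespace PolyBounded

variable {ι κ : Type} {sz f g : ι → ℕ}

theorem mono (hg : PolyBounded sz g) (h : ∀ a, f a ≤ g a) : PolyBounded sz f :=
  hg.imp fun _ hP a => (h a).trans (hP a)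

theorem const (c : ℕ) : PolyBounded sz fun _ => c :=
  ⟨.C c, fun _ => by simp⟩

theorem add (hf : PolyBounded sz f) (hg : PolyBounded sz g) :
    PolyBounded sz fun a => f a + g a := by
  obtain ⟨P, hP⟩ := hf
  obtain ⟨Q, hQ⟩ := hg
  exact ⟨P + Q, fun a => by simpa using add_le_add (hP a) (hQ a)⟩

theorem mul (hf : PolyBounded sz f) (hg : PolyBounded sz g) :
    PolyBounded sz fun a => f a * g a := by
  obtain ⟨P, hP⟩ := hf
  obtain ⟨Q, hQ⟩ := hg
  exact ⟨P * Q, fun a => by simpa using Nat.mul_le_mul (hP a) (hQ a)⟩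

theorem eval (Q : Polynomial ℕ) (hf : PolyBounded sz f) :
    PolyBounded sz fun a => Q.eval (f a) := by
  obtain ⟨P, hP⟩ := hf
  exact ⟨Q.comp P, fun a => by simpa using eval_mono Q (hP a)⟩

theorem comp (h : PolyBounded sz f) (φ : κ → ι) : PolyBounded (sz ∘ φ) (f ∘ φ) :=
  h.imp fun _ hP a => hP (φ a)

end PolyBounded

namespace Prog

variable {R : Type} [DecidableEq R] {A : TM2ComputableAux Bool Bool}

theorem Run.length_le {p : Prog R} {s s' : R → List Bool} {t : ℕ} (h : Run A p s s' t) (r : R) :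
    (s' r).length ≤ (s r).length + t := by
  have hupdate (s : R → List Bool) {r₀ : R} {l : List Bool} {c : ℕ}
      (hl : l.length ≤ (s r₀).length + c) :
      (Function.update s r₀ l r).length ≤ (s r).length + c := by
    by_cases hr : r = r₀
    · subst hr
      simpa using hl
    · simp [hr]
  induction h with
  | skip s => simp
  | push r₀ b s => exact hupdate s (by simp)
  | seq _ _ ih ih' => lia
  | @case r₀ _ s s' t _ ih =>
    have := hupdate s (r₀ := r₀) (l := (s r₀).tail) (c := 0) (by simp)
    lia
  | loop_nil => simp
  | @loop_exit r₀ _ _ s s' t b l hs _ _ ih =>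
    have := hupdate s (r₀ := r₀) (l := l) (c := 0) (by simp [hs])
    lia
  | @loop_cont r₀ _ _ s s' s'' t t' b l hs _ _ _ ih ih' =>
    have := hupdate s (r₀ := r₀) (l := l) (c := 0) (by simp [hs])
    lia
  | @call r₀ r₁ s x y t _ _ _ =>
    have h₀ := hupdate s (r₀ := r₀) (l := []) (c := 0) (by simp)
    by_cases h₁ : r = r₁
    · subst h₁
      simp only [Function.update_self, List.length_append, List.length_reverse]
      lia
    · rw [Function.update_of_ne h₁]
      lia
  | mono _ _ ih => lia

/-! ### Loops -/

/-- The loop body may depend on the symbols popped so far: `σ u` are the stacks after these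
were `u`, disregarding the stack `r` itself. -/
theorem Run.iterate {r : R} {cont : Bool → Bool} {body : Bool → Prog R}
    (σ : List Bool → R → List Bool) {c : ℕ} (l : List Bool)
    (h : ∀ u b v, l = u ++ b :: v → Run A (body b)
      (Function.update (σ u) r v) (Function.update (σ (u ++ [b])) r v) c) :
    Run A (loop r cont body) (Function.update (σ []) r l)
      (Function.update (σ (l.takeWhile cont ++ (l.dropWhile cont).take 1)) r
        (l.dropWhile cont).tail) (l.length * (c + 1) + 1) := by
  suffices ∀ v u, l = u ++ v → Run A (loop r cont body) (Function.update (σ u) r v)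
      (Function.update (σ (u ++ (v.takeWhile cont ++ (v.dropWhile cont).take 1))) r
        (v.dropWhile cont).tail) (v.length * (c + 1) + 1) from this l [] rfl
  intro v
  induction v with
  | nil =>
    rintro u rfl
    simpa using Run.loop_nil (A := A) (s := Function.update (σ u) r []) (by simp)
  | cons b v ih =>
    intro u hu
    have hbody := h u b v hu
    have hpop : Function.update (σ u) r (b :: v) r = b :: v := Function.update_self ..
    rw [← Function.update_idem (a := r) (v := b :: v)] at hbody
    cases hb : cont b with
    | false =>
      refine Run.mono (by simpa [hb] using Run.loop_exit hpop hb hbody) ?_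
      rw [List.length_cons]
      lia
    | true =>
      have hrest := ih (u ++ [b]) (by simpa using hu)
      refine Run.mono (by simpa [hb] using Run.loop_cont hpop hb hbody hrest) ?_
      rw [List.length_cons]
      lia

theorem Run.forEach {r : R} {body : Bool → Prog R} (σ : List Bool → R → List Bool) {c : ℕ}
    (l : List Bool) (h : ∀ u b v, l = u ++ b :: v → Run A (body b)
      (Function.update (σ u) r v) (Function.update (σ (u ++ [b])) r v) c) :
    Run A (loop r (fun _ => true) body) (Function.update (σ []) r l)
      (Function.update (σ l) r []) (l.length * (c + 1) + 1) := by
  simpa [List.takeWhile_eq_self_iff.2, List.dropWhile_eq_nil_iff.2] using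
    Run.iterate (cont := fun _ => true) σ l h

theorem run_move {r r' : R} (h : r ≠ r') (g : Bool → Bool) (s : R → List Bool) :
    Run A (loop r (fun _ => true) fun b => push r' (g b)) s
      (Function.update (Function.update s r []) r' (((s r).map g).reverse ++ s r'))
      ((s r).length * 2 + 1) := by
  have hrun := Run.forEach (A := A) (body := fun b => push r' (g b)) (r := r) (c := 1)
    (fun u => Function.update s r' ((u.map g).reverse ++ s r')) (s r) fun u b v _ => by
      convert Run.push (A := A) r' (g b) _ using 1
      simp [Function.update_comm h, h.symm]
  simpa [Function.update_comm h] using hrun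

/-- For every element of `r`, push `true` onto `r₁`; the contents of `r` are saved on `r₂` and
restored. -/
def tally (r r₁ r₂ : R) : Prog R :=
  seq (loop r (fun _ => true) fun b => seq (push r₁ true) (push r₂ b))
    (loop r₂ (fun _ => true) fun b => push r b)

theorem run_tally {r r₁ r₂ : R} (h₁ : r ≠ r₁) (h₂ : r ≠ r₂) (h₁₂ : r₁ ≠ r₂) {s : R → List Bool}
    (hs : s r₂ = []) :
    Run A (tally r r₁ r₂) s (Function.update s r₁ (List.replicate (s r).length true ++ s r₁))
      ((s r).length * 5 + 2) := by
  have hsave := Run.forEach (A := A) (r := r) (c := 2)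
    (body := fun b => seq (push r₁ true) (push r₂ b)) (fun u => Function.update
      (Function.update s r₁ (List.replicate u.length true ++ s r₁)) r₂ u.reverse) (s r)
    fun u b v _ => by
      convert Run.seq (Run.push (A := A) r₁ true _) (Run.push r₂ b _) using 1
      funext k
      simp only [Function.update_apply]
      split_ifs <;> simp_all [List.replicate_succ]
  have hrestore := run_move (A := A) h₂.symm id (Function.update (Function.update
    (Function.update s r₁ (List.replicate (s r).length true ++ s r₁)) r₂ (s r).reverse) r [])
  have hrun : Run A (tally r r₁ r₂) _ _ _ := hsave.seq hrestore
  rw [Function.update_of_ne h₂.symm, Function.update_self] at hrun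
  convert hrun.mono (u := (s r).length * 5 + 2) (by rw [List.length_reverse]; lia) using 1
  · funext k
    simp only [Function.update_apply]
    split_ifs <;> simp_all
  · funext k
    simp only [Function.update_apply]
    split_ifs <;> simp_all

end Prog

/-! ### Programs on named stacks -/

namespace Prog

/-- The stacks of the programs below, named after the data they hold at the beginning. -/
inductive Reg
  | inp | out | prec | zeros | ones | arg | res | mark | bad | acc | tmp
  deriving DecidableEq

instance : Fintype Reg :=
  ⟨{.inp, .out, .prec, .zeros, .ones, .arg, .res, .mark, .bad, .acc, .tmp},
    fun r => by cases r <;> decide⟩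

/-- The contents of the stacks, top first. -/
structure Stacks where
  inp : List Bool := []
  out : List Bool := []
  prec : List Bool := []
  zeros : List Bool := []
  ones : List Bool := []
  arg : List Bool := []
  res : List Bool := []
  mark : List Bool := []
  bad : List Bool := []
  acc : List Bool := []
  tmp : List Bool := []

namespace Stacks

/-- The contents of a given stack. -/
def get (S : Stacks) : Reg → List Bool
  | .inp => S.inp
  | .out => S.out
  | .prec => S.prec
  | .zeros => S.zeros
  | .ones => S.ones
  | .arg => S.arg
  | .res => S.res
  | .mark => S.mark
  | .bad => S.bad
  | .acc => S.acc
  | .tmp => S.tmp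

/-- Replace the contents of a given stack. -/
def set (S : Stacks) (r : Reg) (l : List Bool) : Stacks :=
  match r with
  | .inp => { S with inp := l }
  | .out => { S with out := l }
  | .prec => { S with prec := l }
  | .zeros => { S with zeros := l }
  | .ones => { S with ones := l }
  | .arg => { S with arg := l }
  | .res => { S with res := l }
  | .mark => { S with mark := l }
  | .bad => { S with bad := l }
  | .acc => { S with acc := l }
  | .tmp => { S with tmp := l }

theorem get_set (S : Stacks) (r : Reg) (l : List Bool) :
    (S.set r l).get = Function.update S.get r l := by
  funext r'
  cases r <;> cases r' <;> rfl

theorem get_injective : Function.Injective get := fun S S' h => by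
  cases S
  cases S'
  congr
  exacts [congrFun h .inp, congrFun h .out, congrFun h .prec, congrFun h .zeros, congrFun h .ones,
    congrFun h .arg, congrFun h .res, congrFun h .mark, congrFun h .bad, congrFun h .acc,
    congrFun h .tmp]

end Stacks

open Reg

variable {A : TM2ComputableAux Bool Bool} {ι : Type} {sz : ι → ℕ} {S S' S'' : ι → Stacks}
  {r r' r₁ r₂ : Reg}

/-- There is a single program which, for every instance `a`, transforms the stacks `S a` into
`S' a`, in time polynomial in `sz a` provided that the sizes of the stacks `S a` are. -/
def PolyRun (A : TM2ComputableAux Bool Bool) (sz : ι → ℕ) (S S' : ι → Stacks) : Prop :=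
  ∃ p : Prog Reg, (∀ r, PolyBounded sz fun a => ((S a).get r).length) →
    ∃ t, PolyBounded sz t ∧ ∀ a, Run A p (S a).get (S' a).get (t a)

namespace PolyRun

theorem trans (h : PolyRun A sz S S') (h' : PolyRun A sz S' S'') : PolyRun A sz S S'' := by
  obtain ⟨p, hp⟩ := h
  obtain ⟨q, hq⟩ := h'
  refine ⟨seq p q, fun hS => ?_⟩
  obtain ⟨t, ht, hrun⟩ := hp hS
  obtain ⟨t', ht', hrun'⟩ := hq fun r => ((hS r).add ht).mono fun a => (hrun a).length_le r
  exact ⟨_, ht.add ht', fun a => (hrun a).seq (hrun' a)⟩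

instance : Trans (PolyRun (ι := ι) A sz) (PolyRun A sz) (PolyRun A sz) := ⟨trans⟩

theorem of_eq (h : ∀ a, S' a = S a) : PolyRun A sz S S' :=
  ⟨skip, fun _ => ⟨_, .const 1, fun a => by simpa only [h] using .skip (S a).get⟩⟩

theorem push (r : Reg) (b : Bool) (h : ∀ a, S' a = (S a).set r (b :: (S a).get r)) :
    PolyRun A sz S S' :=
  ⟨.push r b, fun _ => ⟨_, .const 1, fun a => by
    simpa only [h, Stacks.get_set] using .push r b (S a).get⟩⟩

theorem case (r : Reg) (h : ∀ o, PolyRun A (fun a : {a // ((S a).get r).head? = o} => sz a)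
    (fun a => (S a).set r ((S a).get r).tail) fun a => S' a) : PolyRun A sz S S' := by
  choose p hp using h
  refine ⟨.case r p, fun hS => ?_⟩
  have hbound (o : Option Bool) := hp o fun r' => by
    refine ((hS r').comp Subtype.val).mono fun a => ?_
    by_cases hr : r' = r
    · subst hr
      simp [Stacks.get_set]
    · simp [Stacks.get_set, hr]
  choose t ht hrun using hbound
  choose P hP using ht
  refine ⟨_, ⟨P none + P (some false) + P (some true) + 1, fun a => le_rfl⟩, fun a => ?_⟩
  have hbody := hrun _ ⟨a, rfl⟩
  rw [Stacks.get_set] at hbody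
  refine Run.mono (Run.case hbody) ?_
  have hle (o : Option Bool) : (P o).eval (sz a) ≤
      (P none + P (some false) + P (some true)).eval (sz a) := by
    simp only [Polynomial.eval_add]
    rcases o with _ | _ | _ <;> lia
  simpa using (hP _ ⟨a, rfl⟩).trans (hle _)

theorem drop (r : Reg) (h : ∀ a, S' a = (S a).set r ((S a).get r).tail) : PolyRun A sz S S' :=
  case r fun _ => of_eq fun a => h a

theorem iterate (r : Reg) {cont : Bool → Bool} {body : Bool → Prog Reg}
    (σ : ι → List Bool → Reg → List Bool) {c : ι → ℕ}
    (hc : (∀ r, PolyBounded sz fun a => ((S a).get r).length) → PolyBounded sz c)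
    (h₀ : ∀ a, (S a).get = Function.update (σ a []) r ((S a).get r))
    (h : ∀ a u b v, (S a).get r = u ++ b :: v → Run A (body b) (Function.update (σ a u) r v)
      (Function.update (σ a (u ++ [b])) r v) (c a))
    (h₁ : ∀ a, (S' a).get = Function.update
      (σ a (((S a).get r).takeWhile cont ++ (((S a).get r).dropWhile cont).take 1)) r
      (((S a).get r).dropWhile cont).tail) : PolyRun A sz S S' :=
  ⟨loop r cont body, fun hS => ⟨_, ((hS r).mul ((hc hS).add (.const 1))).add (.const 1), fun a => by
    rw [h₀ a, h₁ a, Function.update_self]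
    exact Run.iterate (σ a) _ (h a)⟩⟩

theorem forEach (r : Reg) {body : Bool → Prog Reg}
    (σ : ι → List Bool → Reg → List Bool) {c : ι → ℕ}
    (hc : (∀ r, PolyBounded sz fun a => ((S a).get r).length) → PolyBounded sz c)
    (h₀ : ∀ a, (S a).get = Function.update (σ a []) r ((S a).get r))
    (h : ∀ a u b v, (S a).get r = u ++ b :: v → Run A (body b) (Function.update (σ a u) r v)
      (Function.update (σ a (u ++ [b])) r v) (c a))
    (h₁ : ∀ a, (S' a).get = Function.update (σ a ((S a).get r)) r []) : PolyRun A sz S S' :=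
  iterate r (cont := fun _ => true) σ hc h₀ h fun a => by
    simpa [List.takeWhile_eq_self_iff.2, List.dropWhile_eq_nil_iff.2] using h₁ a

/-- The program pushing the bit in `o`, if there is one. -/
def pushOption (r : Reg) : Option Bool → Prog Reg
  | none => .skip
  | some b => .push r b

theorem run_pushOption {α : Type} (r : Reg) (g : α → Option Bool) (x : α) (s : Reg → List Bool) :
    Run A (pushOption r (g x)) s (Function.update s r (([x].filterMap g).reverse ++ s r)) 1 := by
  cases hx : g x with
  | none => simpa [pushOption, hx] using Run.skip s
  | some b => simpa [pushOption, hx] using Run.push r b s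

theorem transfer (r r' : Reg) (cont : Bool → Bool) (g : Bool → Option Bool) (hr : r ≠ r')
    (h : ∀ a, S' a = ((S a).set r (((S a).get r).dropWhile cont).tail).set r'
      (((((S a).get r).takeWhile cont ++
        (((S a).get r).dropWhile cont).take 1).filterMap g).reverse ++ (S a).get r')) :
    PolyRun A sz S S' :=
  iterate r (cont := cont) (body := fun b => pushOption r' (g b))
    (fun a u => Function.update (S a).get r' ((u.filterMap g).reverse ++ (S a).get r'))
    (fun _ => .const 1)
    (fun a => by simp)
    (fun a u b v _ => by
      convert run_pushOption r' g b _ using 1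
      simp [Function.update_comm hr, Function.update_of_ne hr.symm, List.filterMap_append])
    fun a => by simp [h, Stacks.get_set, Function.update_comm hr]

/-- The results of popping a stack `n` times. -/
def pops (n : ℕ) (l : List Bool) : List (Option Bool) :=
  (l.take n).map some ++ List.replicate (n - l.length) none

theorem pops_succ (n : ℕ) (l : List Bool) : pops (n + 1) l = pops n l ++ [(l.drop n).head?] := by
  rw [pops, pops, List.take_add_one, List.map_append, ← List.head?_drop]
  rcases lt_or_ge n l.length with hn | hn
  · rw [Nat.sub_eq_zero_of_le hn, Nat.sub_eq_zero_of_le hn.le]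
    simp [List.head?_drop, hn]
  · rw [Nat.succ_sub hn, List.replicate_succ', List.drop_of_length_le hn]
    simp

theorem popEach (r r₁ r₂ : Reg) (g : Option Bool → Option Bool) (h₁ : r ≠ r₁) (h₂ : r ≠ r₂)
    (h₁₂ : r₁ ≠ r₂)
    (h : ∀ a, S' a = (((S a).set r []).set r₁ (((S a).get r₁).drop ((S a).get r).length)).set r₂
      (((pops ((S a).get r).length ((S a).get r₁)).filterMap g).reverse ++ (S a).get r₂)) :
    PolyRun A sz S S' :=
  forEach r (body := fun _ => .case r₁ fun o => pushOption r₂ (g o))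
    (fun a u => Function.update (Function.update (S a).get r₁ (((S a).get r₁).drop u.length))
      r₂ (((pops u.length ((S a).get r₁)).filterMap g).reverse ++ (S a).get r₂))
    (fun _ => .const 2)
    (fun a => by simp [pops])
    (fun a u b v _ => by
      refine Run.case ?_
      convert run_pushOption r₂ g _ _ using 1
      simp [Function.update_comm h₁, Function.update_comm h₂, Function.update_comm h₁₂,
        Function.update_of_ne h₁.symm, Function.update_of_ne h₂.symm,
        Function.update_of_ne h₁₂.symm, pops_succ, List.filterMap_append])
    fun a => by simp [h, Stacks.get_set, Function.update_comm h₁, Function.update_comm h₂]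

theorem move (r r' : Reg) (hr : r ≠ r')
    (h : ∀ a, S' a = ((S a).set r []).set r' (((S a).get r).reverse ++ (S a).get r')) :
    PolyRun A sz S S' :=
  transfer r r' (fun _ => true) some hr fun a => by
    simpa [List.takeWhile_eq_self_iff.2, List.dropWhile_eq_nil_iff.2] using h a

theorem clear (r : Reg) (h : ∀ a, S' a = (S a).set r []) : PolyRun A sz S S' :=
  forEach r (body := fun _ => .skip) (fun a _ => (S a).get) (fun _ => .const 1)
    (fun a => by simp) (fun _ _ _ _ _ => .skip _) fun a => by simp [h, Stacks.get_set]

theorem tally (r r₁ r₂ : Reg) (h₁ : r ≠ r₁) (h₂ : r ≠ r₂) (h₁₂ : r₁ ≠ r₂)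
    (hr₂ : ∀ a, (S a).get r₂ = [])
    (h : ∀ a, S' a = (S a).set r₁ (List.replicate ((S a).get r).length true ++ (S a).get r₁)) :
    PolyRun A sz S S' :=
  ⟨.tally r r₁ r₂, fun hS => ⟨_, ((hS r).mul (.const 5)).add (.const 2), fun a => by
    simpa only [h, Stacks.get_set] using run_tally h₁ h₂ h₁₂ (hr₂ a)⟩⟩

theorem call (r r' : Reg) (hr : r ≠ r') {x y : ι → List Bool} {T : Polynomial ℕ}
    (hrun : ∀ a, Outputs A (x a) (y a) (T.eval (x a).length))
    (hy : PolyBounded sz fun a => (y a).length) (hx : ∀ a, (S a).get r = (x a).reverse)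
    (h : ∀ a, S' a = ((S a).set r []).set r' ((y a).reverse ++ (S a).get r')) :
    PolyRun A sz S S' :=
  ⟨.call r r', fun hS => by
    have hlen : PolyBounded sz fun a => (x a).length := (hS r).mono fun a => by simp [hx]
    exact ⟨_, ((hlen.add (.const 1)).add (hlen.eval T)).add (hy.add (.const 1)), fun a => by
      simpa only [h, Stacks.get_set] using .call hr (hx a) (hrun a)⟩⟩

theorem pushes (r : Reg) (l : List Bool) (h : ∀ a, S' a = (S a).set r (l ++ (S a).get r)) :
    PolyRun A sz S S' := by
  induction l generalizing S' with
  | nil => exact of_eq fun a => Stacks.get_injective (by simp [h, Stacks.get_set])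
  | cons b l ih =>
    exact (ih fun a => rfl).trans (push r b fun a =>
      Stacks.get_injective (by simp [h, Stacks.get_set]))

theorem multiply (r r₀ r₁ r₂ : Reg) (h₀ : r ≠ r₀) (h₁ : r ≠ r₁) (h₂ : r ≠ r₂) (h₀₁ : r₀ ≠ r₁)
    (h₀₂ : r₀ ≠ r₂) (h₁₂ : r₁ ≠ r₂) (hr₂ : ∀ a, (S a).get r₂ = [])
    (h : ∀ a, S' a = ((S a).set r₀ []).set r₁
      (List.replicate (((S a).get r₀).length * ((S a).get r).length) true ++ (S a).get r₁)) :
    PolyRun A sz S S' :=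
  forEach r₀ (body := fun _ => .tally r r₁ r₂)
    (fun a u => Function.update (S a).get r₁
      (List.replicate (u.length * ((S a).get r).length) true ++ (S a).get r₁))
    (fun hS => ((hS r).mul (.const 5)).add (.const 2))
    (fun a => by simp)
    (fun a u b v _ => by
      have hr (s : Reg → List Bool) (l l' : List Bool) :
          Function.update (Function.update s r₁ l) r₀ l' r = s r := by simp [h₀, h₁]
      have hrun := run_tally (A := A) h₁ h₂ h₁₂ (s := Function.update (Function.update (S a).get r₁
        (List.replicate (u.length * ((S a).get r).length) true ++ (S a).get r₁)) r₀ v)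
        (by simp [h₀₂.symm, h₁₂.symm, hr₂])
      rw [hr] at hrun
      convert hrun using 1
      rw [Function.update_comm h₀₁, List.length_append, add_comm, add_mul, List.replicate_add]
      simp [Function.update_of_ne h₀₁.symm, -List.replicate_append_replicate])
    fun a => by simp [h, Stacks.get_set, Function.update_comm h₀₁]

attribute [local simp] Stacks.get Stacks.set

/-- Horner's rule, with the argument and the value of the polynomial in unary. -/
theorem evalPoly (q : Polynomial ℕ) (hS : ∀ a, (S a).acc = [] ∧ (S a).arg = [] ∧ (S a).tmp = [])
    (h : ∀ a, S' a = { S a with acc := List.replicate (q.eval (S a).ones.length) true }) :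
    PolyRun A sz S S' := by
  obtain rfl : S' = _ := funext h
  clear h
  induction q using Polynomial.recOnHorner with
  | M0 => exact of_eq fun a => by simp [← (hS a).1]
  | MC q c _ _ ih =>
    exact ih.trans <| pushes acc (List.replicate c true) fun a => by simp [add_comm _ c]
  | MX q _ ih =>
    let e a := q.eval (S a).ones.length
    calc
      PolyRun A sz S fun a => { S a with acc := List.replicate (e a) true } := ih
      PolyRun A sz _ fun a => { S a with arg := List.replicate (e a) true } :=
        move acc arg nofun fun a => by simp [e, hS]
      PolyRun A sz _ _ := multiply ones arg acc tmp nofun nofun nofun nofun nofun nofun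
        (fun a => (hS a).2.2) fun a => by simp [e, hS]

end PolyRun

theorem polyTime_of_polyRun {α β : Type} {ea : α → List Bool} {eb : β → List Bool} {F : α → β}
    (h : PolyRun A (fun a => (ea a).length) (fun a => { inp := ea a })
      fun a => { out := eb (F a) }) : PolyTime ea eb F := by
  obtain ⟨p, hp⟩ := h
  obtain ⟨t, ⟨P, hP⟩, hrun⟩ := hp fun r =>
    ⟨.X, fun a => by cases r <;> simp [Stacks.get]⟩
  refine polyTime_of_run (A := A) p inp out P fun a => ?_
  convert (hrun a).mono (hP a) using 1
  all_goals
    funext r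
    cases r <;> rfl

end Prog

namespace Prog

open Reg

variable {A : TM2ComputableAux Bool Bool} {ι : Type} {sz : ι → ℕ} {S S' : ι → Stacks}
  {r r' r₁ r₂ : Reg}

namespace PolyRun

theorem readRun (b : Bool) (r r' : Reg) (hr : r ≠ r')
    (h : ∀ a, S' a = ((S a).set r (afterRun b ((S a).get r))).set r'
      (List.replicate (runLength b ((S a).get r)) true ++ (S a).get r')) :
    PolyRun A sz S S' :=
  transfer r r' (· == b) (fun c => if c = b then some true else none) hr fun a => by
    rw [h a, takeWhile_eq_replicate_runLength]
    have hhead := List.head?_dropWhile_not (· == b) ((S a).get r)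
    rw [afterRun]
    generalize ((S a).get r).dropWhile (· == b) = l at *
    cases l <;> simp_all

theorem subtract (r r₁ r₂ : Reg) (h₁ : r ≠ r₁) (h₂ : r ≠ r₂) (h₁₂ : r₁ ≠ r₂)
    (h : ∀ a, S' a = (((S a).set r []).set r₁ (((S a).get r₁).drop ((S a).get r).length)).set r₂
      (List.replicate (((S a).get r).length - ((S a).get r₁).length) true ++ (S a).get r₂)) :
    PolyRun A sz S S' :=
  popEach r r₁ r₂ (fun o => if o = none then some true else none) h₁ h₂ h₁₂ fun a => by
    rw [h, pops, List.filterMap_append, List.filterMap_map]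
    simp

attribute [local simp] Stacks.get Stacks.set

open Computability

theorem parse {sz : ℕ × ℤ → ℕ} : PolyRun A sz (fun a : ℕ × ℤ => { inp := encodeNatInt a }) fun a =>
    { prec := List.replicate a.1 true
      zeros := List.replicate (runLength false (encodeNat a.2.natAbs)) true
      ones := List.replicate (codeIndex (encodeNat a.2.natAbs)) true
      inp := codeWord (encodeNat a.2.natAbs)
      bad := if a.2 < 0 then [true] else [] } := by
  calc
    PolyRun A sz _ fun a => { prec := List.replicate a.1 true, inp := encodeInt a.2 } :=
      readRun true inp prec nofun fun a => by
        rw [encodeNatInt, unaryPair, unaryEncodeNat_eq]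
        simp [runLength_replicate_append, afterRun_replicate_append]
    PolyRun A sz _ fun a =>
        { prec := List.replicate a.1 true, inp := encodeNat a.2.natAbs
          bad := if a.2 < 0 then [true] else [] } :=
      transfer inp bad (fun _ => false) (fun b => if b then some true else none) nofun
        fun a => by by_cases ha : a.2 < 0 <;> simp [encodeInt, ha]
    PolyRun A sz _ _ := (readRun false inp zeros nofun fun _ => rfl).trans
      (readRun true inp ones nofun fun _ => by simp [codeIndex, codeWord])

theorem checkZeros (L : Polynomial ℕ)
    (hS : ∀ a, (S a).acc = [] ∧ (S a).arg = [] ∧ (S a).tmp = [])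
    (h : ∀ a, S' a = { S a with
      zeros := []
      bad := List.replicate (L.eval (S a).ones.length - (S a).zeros.length) true ++
        (List.replicate ((S a).zeros.length - L.eval (S a).ones.length) true ++ (S a).bad) }) :
    PolyRun A sz S S' := by
  obtain rfl : S' = _ := funext h
  exact (evalPoly L hS fun _ => rfl).trans <|
    (subtract zeros acc bad nofun nofun nofun fun _ => rfl).trans <|
      move acc bad nofun fun a => by simp [hS]

theorem popFirst (hS : ∀ a, (S a).tmp = [])
    (h : ∀ a, S' a = { S a with
      inp := (S a).inp.tail
      bad := List.replicate (1 - (S a).inp.length) true ++ (S a).bad }) : PolyRun A sz S S' :=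
  (push tmp true fun _ => rfl).trans <|
    subtract tmp inp bad nofun nofun nofun fun a => by simp [hS, h]

theorem query {χ : List Bool → Bool} {T : Polynomial ℕ}
    (hA : ∀ x, Outputs A x [χ x] (T.eval x.length))
    (hS : ∀ a, (S a).arg = [] ∧ (S a).res = [] ∧ (S a).mark = [] ∧ (S a).tmp = [])
    (h : ∀ a, S' a = { S a with
      inp := []
      mark := List.replicate (S a).inp.length true
      res := [χ (unaryPair (S a).ones.length (S a).inp).dropLast] }) : PolyRun A sz S S' := by
  let x a := (unaryPair (S a).ones.length (S a).inp).dropLast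
  calc
    PolyRun A sz S fun a =>
        { S a with arg := false :: List.replicate (S a).ones.length true } :=
      (tally ones arg tmp nofun nofun nofun (fun a => (hS a).2.2.2) fun _ => rfl).trans <|
        push arg false fun a => by simp [hS]
    PolyRun A sz _ fun a => { S a with
        inp := []
        mark := List.replicate (S a).inp.length true
        arg := (unaryPair (S a).ones.length (S a).inp).reverse } :=
      (tally inp mark tmp nofun nofun nofun (fun a => by simp [hS]) fun _ => rfl).trans <|
        move inp arg nofun fun a => by simp [hS, unaryPair, unaryEncodeNat_eq]
    PolyRun A sz _ fun a => { S a with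
        inp := []
        mark := List.replicate (S a).inp.length true
        arg := (x a).reverse } :=
      drop arg fun a => by simp [x]
    PolyRun A sz _ _ :=
      call arg res nofun (fun a => hA (x a)) (.const 1) (fun _ => rfl)
        fun a => by simp [h, hS, x]

theorem checkWord (q : Polynomial ℕ) {y : ι → Bool}
    (hS : ∀ a, (S a).zeros = [] ∧ (S a).res = [y a] ∧ (S a).acc = [] ∧ (S a).arg = [] ∧
      (S a).tmp = [])
    (h : ∀ a, S' a = { S a with
      mark := []
      res := []
      bad := (if (S a).mark ≠ [] ∧ y a = false then [true] else []) ++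
        (List.replicate ((S a).mark.length - q.eval (S a).ones.length) true ++ (S a).bad) }) :
    PolyRun A sz S S' :=
  calc
    PolyRun A sz S fun a => { S a with
        zeros := List.replicate (S a).mark.length true
        acc := List.replicate (q.eval (S a).ones.length) true } :=
      (tally mark zeros tmp nofun nofun nofun (by simp [hS]) fun _ => rfl).trans <|
        evalPoly q (by simp [hS]) fun a => by simp [hS]
    PolyRun A sz _ fun a => { S a with
        mark := []
        zeros := List.replicate (S a).mark.length true
        bad := List.replicate ((S a).mark.length - q.eval (S a).ones.length) true ++ (S a).bad } :=
      (subtract mark acc bad nofun nofun nofun fun _ => rfl).trans <|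
        clear acc fun a => by simp [hS]
    PolyRun A sz _ _ :=
      (popEach zeros res bad (fun o => if o = some false then some true else none) nofun nofun
        nofun fun _ => rfl).trans <| clear res fun a => by
          rcases hm : (S a).mark with _ | ⟨b, l⟩ <;> cases hy : y a <;> simp [h, hS, pops, hm, hy]

theorem checkPrecision (D : Polynomial ℕ)
    (hS : ∀ a, (S a).acc = [] ∧ (S a).arg = [] ∧ (S a).tmp = [])
    (h : ∀ a, S' a = { S a with
      prec := (S a).prec.drop (D.eval (S a).ones.length)
      bad := List.replicate (D.eval (S a).ones.length - (S a).prec.length) true ++ (S a).bad }) :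
    PolyRun A sz S S' :=
  (evalPoly D hS fun _ => rfl).trans <|
    subtract acc prec bad nofun nofun nofun fun a => by simp [h, hS]

theorem emit {N : ι → ℕ} {B : ι → List Bool} (hS : ∀ a, S a =
      { prec := List.replicate (N a) true, bad := B a })
    (h : ∀ a, S' a = { out := encodeInt (if B a = [] then 2 ^ N a else 0) }) :
    PolyRun A sz S S' := by
  refine case bad fun o => ?_
  cases o with
  | none =>
    have hB (a : {a // ((S a).get bad).head? = none}) : B a = [] := by simpa [hS] using a.2
    exact (push out true fun _ => rfl).trans <|
      (transfer prec out (fun _ => true) (fun _ => some false) nofun fun _ => rfl).trans <|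
        push out false fun a => by simp [h, hS, hB, encodeInt_two_pow]
  | some b =>
    have hB (a : {a // ((S a).get bad).head? = some b}) : B a ≠ [] := by 
      intro h
      simpa [hS, h] using a.2
    exact (clear bad fun _ => rfl).trans <| (clear prec fun _ => rfl).trans <|
      push out false fun a => by simp [h, hS, hB]; rfl

end PolyRun
end Prog

/-! ### Frequencies -/

theorem getLast_encodeNat {n : ℕ} (h : encodeNat n ≠ []) : (encodeNat n).getLast h = true := by
  have hn : n ≠ 0 := by
    rintro rfl
    exact h rfl
  have hlast := Nat.getLast_digit_ne_zero 2 hn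
  simp only [← map_toNat_encodeNat, List.getLast_map] at hlast
  simpa using hlast

/-- The empty word and the words `b w'`, `b` a bit, with `w'` a word accepted for `m`. -/
def words (χ : List Bool → Bool) (p : Polynomial ℕ) (m : ℕ) : Set (List Bool) :=
  {w | w.length ≤ p.eval m + 1 ∧ (w = [] ∨ χ (unaryPair m w.tail) = true)}

/-- The frequency with the binary digits `0ᴸ 1 1ᵐ 0 w 1`, least significant digit first. -/
def freq (L : Polynomial ℕ) (m : ℕ) (w : List Bool) : ℕ :=
  ofBits (blockCode (L.eval m) m (w ++ [true]))

/-- The number `m` of a frequency `0ᴸ 1 1ᵐ 0 w 1`. -/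
def freqIndex (k : ℤ) : ℕ := codeIndex (encodeNat k.natAbs)

/-- The integer `k` is the frequency of one of the words for some `m`. -/
def IsFreq (χ : List Bool → Bool) (p L : Polynomial ℕ) (k : ℤ) : Prop :=
  ∃ m, ∃ w ∈ words χ p m, k = freq L m w

theorem unaryPair_append (m : ℕ) (v w : List Bool) :
    unaryPair m (v ++ w) = unaryPair m v ++ w := by
  simp [unaryPair]

theorem encodeNat_freq (L : Polynomial ℕ) (m : ℕ) (w : List Bool) :
    encodeNat (freq L m w) = blockCode (L.eval m) m (w ++ [true]) := by
  have h : blockCode (L.eval m) m (w ++ [true]) = blockCode (L.eval m) m w ++ [true] := by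
    simp [blockCode, unaryPair_append]
  rw [freq, h, encodeNat_ofBits_append_true]

theorem freqIndex_freq (L : Polynomial ℕ) (m : ℕ) (w : List Bool) :
    freqIndex (freq L m w) = m := by
  rw [freqIndex, Int.natAbs_natCast, encodeNat_freq, codeIndex_blockCode]

theorem freq_injective {L : Polynomial ℕ} {m m' : ℕ} {w w' : List Bool}
    (h : freq L m w = freq L m' w') : m = m' ∧ w = w' := by
  have hcode := congrArg encodeNat h
  rw [encodeNat_freq, encodeNat_freq] at hcode
  have hm := congrArg codeIndex hcode
  have hw := congrArg codeWord hcode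
  rw [codeIndex_blockCode, codeIndex_blockCode] at hm
  rw [codeWord_blockCode, codeWord_blockCode] at hw
  exact ⟨hm, by simpa using hw⟩

theorem dropLast_unaryPair_append {m : ℕ} {w : List Bool} (hw : w ≠ []) :
    (unaryPair m (w ++ [true]).tail).dropLast = unaryPair m w.tail := by
  obtain ⟨b, w, rfl⟩ := List.exists_cons_of_ne_nil hw
  exact (congrArg _ (unaryPair_append m w [true])).trans List.dropLast_concat

theorem isFreq_iff {χ : List Bool → Bool} {p L : Polynomial ℕ} {k : ℤ} {l v : List Bool} {m : ℕ}
    (hl : encodeNat k.natAbs = l) (hm : codeIndex l = m) (hv : codeWord l = v) :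
    IsFreq χ p L k ↔ 0 ≤ k ∧ runLength false l = L.eval m ∧ v ≠ [] ∧
      v.tail.length ≤ p.eval m + 1 ∧
        (v.tail = [] ∨ χ (unaryPair m v.tail).dropLast = true) := by
  constructor
  · rintro ⟨m', w, ⟨hw, hχ⟩, rfl⟩
    rw [Int.natAbs_natCast, encodeNat_freq] at hl
    subst hl hm hv
    rw [codeWord_blockCode, codeIndex_blockCode, runLength_blockCode]
    refine ⟨by positivity, rfl, by simp, by simpa using hw, ?_⟩
    rcases eq_or_ne w [] with rfl | hne
    · exact .inl rfl
    · exact .inr (by rw [dropLast_unaryPair_append hne]; exact hχ.resolve_left hne)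
  · rintro ⟨hk, hz, hne, hlen, hχ⟩
    have hcode : blockCode (L.eval m) m v = l := by
      subst hm hv
      rw [← hz]
      exact blockCode_of_codeWord_ne_nil hne
    have hlast : v.dropLast ++ [true] = v := by
      conv_rhs => rw [← List.dropLast_append_getLast hne]
      have hlast := getLast_encodeNat (n := k.natAbs) (by simp [hl, ← hcode, blockCode])
      simp only [hl, ← hcode, blockCode, unaryPair] at hlast
      simpa [List.getLast_append_of_ne_nil, List.getLast_cons, hne] using hlast
    refine ⟨m, v.dropLast, ⟨by simpa using hlen, ?_⟩, ?_⟩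
    · rcases eq_or_ne v.dropLast [] with h₀ | h₀
      · exact .inl h₀
      · refine .inr ?_
        rw [← dropLast_unaryPair_append h₀, hlast]
        refine hχ.resolve_left fun h => h₀ ?_
        rw [← List.length_eq_zero_iff] at h ⊢
        simpa using h
    · rw [freq, hlast, hcode, ← hl, ofBits_encodeNat, Int.natCast_natAbs, abs_of_nonneg hk]

open Classical in
/-- Integers `c` such that `c / 2ⁿ` approximates the coefficient `2 ^ (-D m)` at the frequencies
belonging to `m`, and zero at the other integers. -/
def coeffApprox (χ : List Bool → Bool) (p L D : Polynomial ℕ) (a : ℕ × ℤ) : ℤ :=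
  if IsFreq χ p L a.2 ∧ D.eval (freqIndex a.2) ≤ a.1 then 2 ^ (a.1 - D.eval (freqIndex a.2)) else 0

/-- A list which is empty if and only if `coeffApprox` does not vanish at `a`. -/
def defects (χ : List Bool → Bool) (p L D : Polynomial ℕ) (a : ℕ × ℤ) : List Bool :=
  let l := encodeNat a.2.natAbs
  let m := codeIndex l
  let v := codeWord l
  List.replicate (D.eval m - a.1) true ++
    ((if v.tail ≠ [] ∧ χ (unaryPair m v.tail).dropLast = false then [true] else []) ++
    (List.replicate (v.tail.length - (p + 1).eval m) true ++
    (List.replicate (1 - v.length) true ++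
    (List.replicate (L.eval m - runLength false l) true ++
    (List.replicate (runLength false l - L.eval m) true ++ if a.2 < 0 then [true] else [])))))

theorem defects_eq_nil_iff {χ : List Bool → Bool} {p L D : Polynomial ℕ} {a : ℕ × ℤ} :
    defects χ p L D a = [] ↔ IsFreq χ p L a.2 ∧ D.eval (freqIndex a.2) ≤ a.1 := by
  rw [isFreq_iff rfl rfl rfl, freqIndex]
  simp only [defects, List.append_eq_nil_iff, List.replicate_eq_nil_iff, ite_eq_right_iff,
    List.cons_ne_nil, imp_false, not_and_or, Bool.not_eq_false, not_lt,
    ← List.length_pos_iff, Polynomial.eval_add, Polynomial.eval_one]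
  grind

theorem coeffApprox_eq_ite_defects (χ : List Bool → Bool) (p L D : Polynomial ℕ) (a : ℕ × ℤ) :
    coeffApprox χ p L D a =
      if defects χ p L D a = [] then 2 ^ (a.1 - D.eval (freqIndex a.2)) else 0 := by
  classical exact if_congr defects_eq_nil_iff.symm rfl rfl

open Prog Prog.PolyRun in
theorem polyTime_coeffApprox {χ : List Bool → Bool} (hχ : PolyTime id encodeBool χ)
    (p L D : Polynomial ℕ) : PolyTime encodeNatInt encodeInt (coeffApprox χ p L D) := by
  obtain ⟨⟨A, T, hA⟩⟩ := hχ
  let sz (a : ℕ × ℤ) := (encodeNatInt a).length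
  let l (a : ℕ × ℤ) := encodeNat a.2.natAbs
  let m a := codeIndex (l a)
  let v a := codeWord (l a)
  let B a := List.replicate (1 - (v a).length) true ++
    (List.replicate (L.eval (m a) - runLength false (l a)) true ++
    (List.replicate (runLength false (l a) - L.eval (m a)) true ++ if a.2 < 0 then [true] else []))
  refine polyTime_of_polyRun (A := A) ?_
  calc
    PolyRun A sz (fun a => { inp := encodeNatInt a }) fun a =>
        { prec := List.replicate a.1 true, ones := List.replicate (m a) true
          inp := (v a).tail, bad := B a } :=
      parse.trans <| (checkZeros L (by simp) fun _ => rfl).trans <|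
        popFirst (by simp) fun a => by simp [m, v, l, B]
    PolyRun A sz _ fun a =>
        { prec := List.replicate a.1 true, ones := List.replicate (m a) true
          mark := List.replicate (v a).tail.length true
          res := [χ (unaryPair (m a) (v a).tail).dropLast], bad := B a } :=
      query (fun x => ⟨hA x⟩) (by simp) fun a => by simp
    PolyRun A sz _ fun a =>
        { prec := List.replicate (a.1 - D.eval (m a)) true, bad := defects χ p L D a } :=
      (checkWord (p + 1) (fun a => ⟨rfl, rfl, rfl, rfl, rfl⟩) fun _ => rfl).trans <|
        (checkPrecision D (by simp) fun _ => rfl).trans <|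
          clear .ones fun a => by simp [defects, m, v, l, B, Stacks.set, ← List.length_eq_zero_iff]
    PolyRun A sz _ fun a => { out := encodeInt (coeffApprox χ p L D a) } :=
      emit (fun _ => rfl) fun a => by rw [coeffApprox_eq_ite_defects]; rfl

/-! ### Extracting binary digits -/

namespace Prog.PolyRun

open Reg

variable {A : TM2ComputableAux Bool Bool} {ι : Type} {sz : ι → ℕ} {S S' : ι → Stacks}

attribute [local simp] Stacks.get Stacks.set

theorem apply {h : ℕ → List Bool} {T : Polynomial ℕ} (q : Polynomial ℕ)
    (hA : ∀ n, Outputs A (unaryEncodeNat n) (h n) (T.eval (unaryEncodeNat n).length))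
    {m : ι → ℕ} (hh : PolyBounded sz fun a => (h (q.eval (m a))).length)
    (hS : ∀ a, S a = { inp := unaryEncodeNat (m a) })
    (hS' : ∀ a, S' a = { ones := List.replicate (m a) true, inp := h (q.eval (m a)) }) :
    PolyRun A sz S S' := by
  calc
    PolyRun A sz S fun a =>
        { ones := List.replicate (m a) true, acc := List.replicate (q.eval (m a)) true } :=
      (move inp ones nofun fun a => rfl).trans <|
        evalPoly q (by simp [hS]) fun a => by simp [hS, unaryEncodeNat_eq]
    PolyRun A sz _ fun a =>
        { ones := List.replicate (m a) true, res := (h (q.eval (m a))).reverse } :=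
      (move acc arg nofun fun a => rfl).trans <|
        call arg res nofun (fun a => hA (q.eval (m a))) hh (by simp [unaryEncodeNat_eq])
          fun a => by simp
    PolyRun A sz _ _ := move res inp nofun fun a => by simp [hS']

theorem dropPoly (c : Polynomial ℕ)
    (hS : ∀ a, (S a).acc = [] ∧ (S a).arg = [] ∧ (S a).tmp = [])
    (h : ∀ a, S' a = { S a with inp := (S a).inp.drop (c.eval (S a).ones.length) }) :
    PolyRun A sz S S' :=
  (evalPoly c hS fun _ => rfl).trans <|
    popEach acc inp tmp (fun _ => none) nofun nofun nofun fun a => by simp [h, hS]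

theorem takePoly (b : Polynomial ℕ)
    (hS : ∀ a, (S a).acc = [] ∧ (S a).arg = [] ∧ (S a).tmp = [] ∧ (S a).res = [])
    (h : ∀ a, S' a = { S a with
      inp := []
      res := ((S a).inp.take (b.eval (S a).ones.length)).reverse }) :
    PolyRun A sz S S' :=
  (evalPoly b (by simp [hS]) fun _ => rfl).trans <|
    (popEach acc inp res id nofun nofun nofun fun _ => rfl).trans <|
      clear inp fun a => by
        simp [h, hS, pops, List.filterMap_append, -List.map_take, List.filterMap_map]

theorem emitStripped {l : ι → List Bool} (hS : ∀ a, S a = { res := (l a).reverse })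
    (h : ∀ a, S' a = { out := encodeNat (ofBits (l a)) }) : PolyRun A sz S S' :=
  (transfer res out (!·) (fun b => if b then some true else none) nofun fun _ => rfl).trans <|
    move res out nofun fun a => by
      have hzeros : ∀ b ∈ (l a).reverse.takeWhile (!·), b = false := fun b hb => by
        simpa using List.mem_takeWhile_imp hb
      have hhead := List.head?_dropWhile_not (!·) (l a).reverse
      simp only [h, encodeNat_ofBits, hS, Stacks.get, Stacks.set]
      generalize (l a).reverse.takeWhile (!·) = u at *
      generalize (l a).reverse.dropWhile (!·) = v at *
      cases v <;> simp_all [List.filterMap_eq_nil_iff]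

end Prog.PolyRun

open Prog Prog.PolyRun in
theorem polyTime_const {α β : Type} (ea : α → List Bool) (eb : β → List Bool) (c : β) :
    PolyTime ea eb fun _ => c :=
  polyTime_of_polyRun (A := default) <| (clear .inp fun _ => rfl).trans <|
    pushes .out (eb c) fun a => by simp [Stacks.set, Stacks.get]

open Prog Prog.PolyRun in
theorem polyTime_extractBits {h : ℕ → ℤ} (hh : PolyTime unaryEncodeNat encodeInt h)
    (q c b r : Polynomial ℕ) (hr : ∀ n, (h (q.eval n)).natAbs < 2 ^ r.eval n) :
    PolyTime unaryEncodeNat encodeNat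
      fun n => (h (q.eval n)).natAbs / 2 ^ c.eval n % 2 ^ b.eval n := by
  obtain ⟨⟨A, T, hA⟩⟩ := hh
  let sz n := (unaryEncodeNat n).length
  let l n := encodeNat (h (q.eval n)).natAbs
  have hlen : PolyBounded sz fun n => (encodeInt (h (q.eval n))).length :=
    ⟨r + 1, fun n => by
      simpa [encodeInt, sz, unaryEncodeNat_eq] using length_encodeNat_le (hr n)⟩
  refine polyTime_of_polyRun (A := A) ?_
  calc
    PolyRun A sz (fun n => { inp := unaryEncodeNat n })
        fun n => { ones := List.replicate n true, inp := encodeInt (h (q.eval n)) } :=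
      apply q (fun n => ⟨hA n⟩) hlen (fun _ => rfl) fun _ => rfl
    PolyRun A sz _ fun n =>
        { ones := List.replicate n true
          res := (((l n).drop (c.eval n)).take (b.eval n)).reverse } :=
      (drop .inp fun _ => rfl).trans <|
        (dropPoly c (fun _ => ⟨rfl, rfl, rfl⟩) fun _ => rfl).trans <|
          takePoly b (fun _ => ⟨rfl, rfl, rfl, rfl⟩) fun n => by
            simp [encodeInt, Stacks.set, Stacks.get, l]
    PolyRun A sz _ _ := (clear .ones fun _ => rfl).trans <|
      emitStripped (fun _ => rfl) fun n => by
        rw [ofBits_take, ofBits_drop, ofBits_encodeNat]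

/-! ### Absolutely convergent trigonometric series -/

/-- The character `exp (2πikt)`. -/
def char (k : ℤ) (t : ℝ) : ℂ := Complex.exp (2 * Real.pi * Complex.I * k * t)

@[fun_prop]
theorem continuous_char (k : ℤ) : Continuous (char k) := by
  unfold char
  fun_prop

theorem char_eq_exp_I_mul (k : ℤ) (t : ℝ) :
    char k t = Complex.exp (Complex.I * ((2 * Real.pi * k * t : ℝ) : ℂ)) := by
  rw [char]
  congr 1
  push_cast
  ring

theorem norm_char (k : ℤ) (t : ℝ) : ‖char k t‖ = 1 := by
  rw [char_eq_exp_I_mul, Complex.norm_exp_I_mul_ofReal]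

theorem char_mul_char (k l : ℤ) (t : ℝ) : char k t * char l t = char (k + l) t := by
  rw [char, char, char, ← Complex.exp_add]
  congr 1
  push_cast
  ring

theorem integral_char_eq_zero {k : ℤ} (hk : k ≠ 0) {b : ℝ} (hb : ∃ n : ℤ, k * b = n) :
    ∫ t in (0 : ℝ)..b, char k t = 0 := by
  obtain ⟨n, hn⟩ := hb
  have hc : 2 * Real.pi * Complex.I * k ≠ 0 := by simp [Real.pi_ne_zero, hk]
  have hperiod : 2 * Real.pi * Complex.I * k * b = n * (2 * Real.pi * Complex.I) := by
    rw [mul_assoc, show (k : ℂ) * b = n by exact_mod_cast congrArg (fun x : ℝ => (x : ℂ)) hn]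
    ring
  unfold char
  rw [integral_exp_mul_complex hc, hperiod, Complex.exp_int_mul_two_pi_mul_I]
  simp

theorem integral_char_mul_char (k l : ℤ) :
    ∫ t, char (-k) t * char l t ∂unitMeasure = if l = k then 1 else 0 := by
  simp only [char_mul_char]
  rw [integral_Icc_eq_integral_Ioc, ← intervalIntegral.integral_of_le zero_le_one]
  split_ifs with h
  · simp [h, char]
  · exact integral_char_eq_zero (by lia) ⟨-k + l, by simp⟩

/-- The average of the character `exp (2πikt)` over the interval `[0, 1/S]`. -/
def charAverage (S : ℕ) (k : ℤ) : ℂ := S * ∫ t in (0 : ℝ)..1 / S, char k t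

theorem charAverage_eq_zero {S : ℕ} {k : ℤ} (hk : k ≠ 0) (h : (S : ℤ) ∣ k) :
    charAverage S k = 0 := by
  obtain ⟨n, rfl⟩ := h
  have hS : (S : ℝ) ≠ 0 := by exact_mod_cast left_ne_zero_of_mul hk
  rw [charAverage, integral_char_eq_zero hk ⟨n, by push_cast; field_simp⟩, mul_zero]

theorem norm_charAverage_sub_one_le {S : ℕ} (hS : 0 < S) (k : ℤ) :
    ‖charAverage S k - 1‖ ≤ 2 * Real.pi * |k| / S := by
  have hS₀ : (0 : ℝ) < S := by exact_mod_cast hS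
  have hb : (0 : ℝ) ≤ 1 / S := by positivity
  have hsub : charAverage S k - 1 = S * ∫ t in (0 : ℝ)..1 / S, (char k t - 1) := by
    rw [intervalIntegral.integral_sub ((continuous_char _).intervalIntegrable _ _)
      (continuous_const.intervalIntegrable _ _)]
    simp [charAverage, mul_sub, hS.ne']
  have hpoint : ∀ t ∈ Set.uIoc (0 : ℝ) (1 / S), ‖char k t - 1‖ ≤ 2 * Real.pi * |k| * (1 / S) := by
    intro t ht
    rw [Set.uIoc_of_le hb] at ht
    rw [char_eq_exp_I_mul]
    refine Real.norm_exp_I_mul_ofReal_sub_one_le.trans ?_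
    rw [Real.norm_eq_abs, abs_mul, abs_mul, abs_of_pos Real.two_pi_pos, abs_of_pos ht.1,
      Int.cast_abs]
    gcongr
    exact ht.2
  have hint := intervalIntegral.norm_integral_le_of_norm_le_const hpoint
  rw [sub_zero, abs_of_nonneg hb] at hint
  rw [hsub, norm_mul, Complex.norm_natCast]
  refine (mul_le_mul_of_nonneg_left hint hS₀.le).trans_eq ?_
  field_simp

/-- The sum of a trigonometric series with coefficients `a i` and frequencies `k i`. -/
def trigSeries {ι : Type*} (a : ι → ℂ) (k : ι → ℤ) (t : ℝ) : ℂ := ∑' i, a i * char (k i) t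

section TrigSeries

variable {ι : Type*} {a : ι → ℂ} {k : ι → ℤ} {f : L2Unit}

theorem norm_mul_char (z : ℂ) (l : ℤ) (t : ℝ) : ‖z * char l t‖ = ‖z‖ := by
  rw [norm_mul, norm_char, mul_one]

theorem hasSum_trigSeries (ha : Summable fun i => ‖a i‖) (k : ι → ℤ) (t : ℝ) :
    HasSum (fun i => a i * char (k i) t) (trigSeries a k t) :=
  (Summable.of_norm (by simpa only [norm_mul_char] using ha)).hasSum

theorem continuous_trigSeries (ha : Summable fun i => ‖a i‖) (k : ι → ℤ) :
    Continuous (trigSeries a k) :=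
  continuous_tsum (fun i => by fun_prop) ha fun i t => (norm_mul_char _ _ _).le

theorem exists_ae_eq_trigSeries (ha : Summable fun i => ‖a i‖) (k : ι → ℤ) :
    ∃ f : L2Unit, f =ᵐ[unitMeasure] trigSeries a k := by
  have hbound (t : ℝ) : ‖trigSeries a k t‖ ≤ ∑' i, ‖a i‖ :=
    tsum_of_norm_bounded ha.hasSum fun i => (norm_mul_char _ _ _).le
  have hmem : MemLp (trigSeries a k) 2 unitMeasure :=
    .of_bound (continuous_trigSeries ha k).aestronglyMeasurable _ (.of_forall hbound)
  exact ⟨hmem.toLp, hmem.coeFn_toLp⟩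

variable [Countable ι]

theorem hasSum_integral_mul_trigSeries (ha : Summable fun i => ‖a i‖) (k : ι → ℤ) {μ : Measure ℝ}
    [IsFiniteMeasure μ] {g : ℝ → ℂ} (hg : Continuous g) (hg₁ : ∀ t, ‖g t‖ ≤ 1) :
    HasSum (fun i => a i * ∫ t, g t * char (k i) t ∂μ) (∫ t, g t * trigSeries a k t ∂μ) := by
  have hnorm (i : ι) (t : ℝ) : ‖g t * (a i * char (k i) t)‖ ≤ ‖a i‖ := by
    rw [norm_mul, norm_mul_char]
    exact mul_le_of_le_one_left (norm_nonneg _) (hg₁ t)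
  have hint (i : ι) : Integrable (fun t => g t * (a i * char (k i) t)) μ :=
    .of_bound (by fun_prop) _ (.of_forall (hnorm i))
  have hsum : Summable fun i => ∫ t, ‖g t * (a i * char (k i) t)‖ ∂μ := by
    refine .of_nonneg_of_le (fun i => integral_nonneg fun t => norm_nonneg _) (fun i => ?_)
      (ha.mul_left (μ.real Set.univ))
    simpa using integral_mono (hint i).norm (integrable_const _) (hnorm i)
  convert! hasSum_integral_of_summable_integral_norm hint hsum using 1
  · simp only [mul_left_comm (g _), integral_const_mul]
  · simp only [tsum_mul_left, trigSeries]

theorem hasSum_fourierCoeff (ha : Summable fun i => ‖a i‖) (hf : f =ᵐ[unitMeasure] trigSeries a k)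
    (l : ℤ) : HasSum (fun i => if k i = l then a i else 0) (fourierCoeff f l) := by
  convert! hasSum_integral_mul_trigSeries ha k (continuous_char (-l))
    (fun t => (norm_char _ _).le) (μ := unitMeasure) using 1
  · simp only [integral_char_mul_char, mul_ite, mul_one, mul_zero]
  · refine integral_congr_ae ?_
    filter_upwards [hf] with t ht
    rw [ht, char]
    push_cast
    ring_nf

theorem fourierCoeff_apply (ha : Summable fun i => ‖a i‖) (hf : f =ᵐ[unitMeasure] trigSeries a k)
    (hk : Function.Injective k) (i : ι) : fourierCoeff f (k i) = a i := by
  have hsingle := hasSum_single (f := fun j => if k j = k i then a j else 0) i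
    fun j hj => if_neg (hk.ne hj)
  rw [if_pos rfl] at hsingle
  exact (hasSum_fourierCoeff ha hf (k i)).unique hsingle

theorem fourierCoeff_eq_zero (ha : Summable fun i => ‖a i‖)
    (hf : f =ᵐ[unitMeasure] trigSeries a k) {l : ℤ} (hl : l ∉ Set.range k) :
    fourierCoeff f l = 0 :=
  (hasSum_fourierCoeff ha hf l).unique (by
    simpa only [if_neg fun h => hl ⟨_, h⟩] using hasSum_zero)

theorem hasSum_fourierPartialSum (ha : Summable fun i => ‖a i‖)
    (hf : f =ᵐ[unitMeasure] trigSeries a k) (K : ℕ) (t : ℝ) :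
    HasSum (fun i => if |k i| ≤ K then a i * char (k i) t else 0) (fourierPartialSum f K t) := by
  convert! hasSum_sum (s := Finset.Icc (-(K : ℤ)) K) fun l _ =>
    (hasSum_fourierCoeff ha hf l).mul_right (char l t) using 1
  simp only [ite_mul, zero_mul, Finset.sum_ite_eq, Finset.mem_Icc, ← abs_le]

theorem eLpNorm_sub_fourierPartialSum_le (ha : Summable fun i => ‖a i‖)
    (hf : f =ᵐ[unitMeasure] trigSeries a k) {K : ℕ} {b : ι → ℝ} (hb : Summable b)
    (hb₀ : ∀ i, 0 ≤ b i) (hab : ∀ i, K < |k i| → ‖a i‖ ≤ b i) :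
    eLpNorm (fun t => f t - fourierPartialSum f K t) 2 unitMeasure
      ≤ ENNReal.ofReal (∑' i, b i) := by
  have hbound (t : ℝ) : ‖trigSeries a k t - fourierPartialSum f K t‖ ≤ ∑' i, b i := by
    rw [← ((hasSum_trigSeries ha k t).sub (hasSum_fourierPartialSum ha hf K t)).tsum_eq]
    refine tsum_of_norm_bounded hb.hasSum fun i => ?_
    split_ifs with hi
    · simpa using hb₀ i
    · rw [sub_zero, norm_mul_char]
      exact hab i (not_le.1 hi)
  refine (eLpNorm_le_of_ae_bound (C := ∑' i, b i) ?_).trans (by simp)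
  filter_upwards [hf] with t ht
  rw [ht]
  exact hbound t

theorem hasSum_stepAverage (ha : Summable fun i => ‖a i‖) (hf : f =ᵐ[unitMeasure] trigSeries a k)
    {S : ℕ} (hS : 0 < S) :
    HasSum (fun i => a i * charAverage S (k i)) (stepAverage f S 0) := by
  have hb₀ : (0 : ℝ) ≤ 1 / S := by positivity
  have hb₁ : (1 : ℝ) / S ≤ 1 := (div_le_one (by exact_mod_cast hS)).2 (by exact_mod_cast hS)
  have hsub : Set.Ioc (0 : ℝ) (1 / S) ⊆ Set.Icc 0 1 :=
    Set.Ioc_subset_Icc_self.trans (Set.Icc_subset_Icc_right hb₁)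
  convert! (hasSum_integral_mul_trigSeries ha k continuous_const (fun _ => norm_one.le)
    (μ := volume.restrict (Set.Ioc (0 : ℝ) (1 / S)))).mul_left (S : ℂ) using 1
  · simp only [charAverage, intervalIntegral.integral_of_le hb₀, one_mul, mul_left_comm (S : ℂ)]
  · simp only [stepAverage, Nat.cast_zero, zero_div, zero_add, one_mul]
    rw [intervalIntegral.integral_of_le hb₀]
    exact congrArg _ (integral_congr_ae (ae_restrict_of_ae_restrict_of_subset hsub hf))

/-- The frequencies divisible by `S` average out, and the characters with small frequencies are
almost constant on `[0, 1/S]`. -/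
theorem norm_stepAverage_sub_le (ha : Summable fun i => ‖a i‖)
    (hf : f =ᵐ[unitMeasure] trigSeries a k) {S : ℕ} (hS : 0 < S) {s : Set ι} {ε : ℝ}
    (hs : ∀ i ∈ s, 2 * Real.pi * |k i| / S ≤ ε) (hε : 0 ≤ ε)
    (hs' : ∀ i ∉ s, k i ≠ 0 ∧ (S : ℤ) ∣ k i) {V : ℂ} (hV : HasSum (s.indicator a) V) :
    ‖stepAverage f S 0 - V‖ ≤ ε * ∑' i, ‖a i‖ := by
  rw [← ((hasSum_stepAverage ha hf hS).sub hV).tsum_eq]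
  refine tsum_of_norm_bounded (ha.hasSum.mul_left ε) fun i => ?_
  by_cases hi : i ∈ s
  · rw [Set.indicator_of_mem hi, ← mul_sub_one, norm_mul, mul_comm]
    gcongr
    exact (norm_charAverage_sub_one_le hS _).trans (hs i hi)
  · rw [Set.indicator_of_notMem hi, charAverage_eq_zero (hs' i hi).1 (hs' i hi).2]
    simpa using by positivity

end TrigSeries

/-! ### The witness -/

theorem freq_lt (L : Polynomial ℕ) (m : ℕ) (w : List Bool) :
    freq L m w < 2 ^ (L.eval m + m + w.length + 3) := by
  refine (ofBits_lt _).trans_eq (congrArg _ ?_)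
  simp [blockCode, unaryPair, unaryEncodeNat_eq]
  ring

theorem freq_ne_zero (L : Polynomial ℕ) (m : ℕ) (w : List Bool) : freq L m w ≠ 0 := by
  intro h
  have hcode := encodeNat_freq L m w
  rw [h] at hcode
  exact List.append_ne_nil_of_right_ne_nil _ (List.cons_ne_nil _ _) hcode.symm

theorem two_pow_dvd_freq (L : Polynomial ℕ) (m : ℕ) (w : List Bool) :
    2 ^ L.eval m ∣ freq L m w := by
  have hzeros (n : ℕ) : ofBits (List.replicate n false) = 0 := by
    simp [ofBits, Nat.ofDigits_replicate_zero]
  rw [freq, blockCode, ofBits_append, hzeros, zero_add, List.length_replicate]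
  exact Dvd.intro _ rfl

theorem ncard_le_of_length_le {s : Set (List Bool)} {n : ℕ} (h : ∀ w ∈ s, w.length ≤ n) :
    s.ncard ≤ 2 ^ (n + 1) := by
  rw [← Set.ncard_Iio_nat (2 ^ (n + 1))]
  refine Set.ncard_le_ncard_of_injOn (fun w => ofBits (w ++ [true])) (fun w hw => ?_)
    (fun w _ w' _ hww' => ?_) (Set.finite_Iio _)
  · refine (ofBits_lt _).trans_le (Nat.pow_le_pow_right two_pos ?_)
    simpa using h w hw
  · have hcode := congrArg encodeNat hww'
    simpa only [encodeNat_ofBits_append_true, List.append_cancel_right_eq] using hcode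

theorem hasSum_sigma_fst {ι : Type*} {β : ι → Type*} [∀ i, Finite (β i)] {c : ι → ℝ} {C : ℝ}
    (hc : ∀ i, 0 ≤ c i) (h : HasSum (fun i => Nat.card (β i) * c i) C) :
    HasSum (fun x : Σ i, β i => c x.1) C := by
  have hfiber (i : ι) : HasSum (fun _ : β i => c i) (Nat.card (β i) * c i) := by
    have := Fintype.ofFinite (β i)
    simpa using hasSum_fintype fun _ : β i => c i
  refine h.sigma_of_hasSum hfiber ((summable_sigma_of_nonneg fun x => hc x.1).2
    ⟨fun i => (hfiber i).summable, ?_⟩)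
  simpa only [(hfiber _).tsum_eq] using h.summable

theorem natAbs_div_four_eq {x : ℕ} {z : ℤ} (h : |(4 * x + 2 : ℝ) - z| < 2) :
    z.natAbs / 4 = x ∧ z.natAbs < 4 * x + 4 := by
  have hz : |(4 * x + 2 : ℤ) - z| < 2 := by exact_mod_cast h
  rw [abs_lt] at hz
  lia

theorem abs_two_pow_mul_sub_re_lt {z : ℂ} {V : ℝ} {N : ℕ} {g : GaussianInt}
    (hV : ‖z - V‖ ≤ (2 ^ N : ℝ)⁻¹ / 2) (hg : ‖z - (g : ℂ) / 2 ^ N‖ ≤ (2 ^ N : ℝ)⁻¹) :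
    |2 ^ N * V - g.re| < 2 := by
  have hre : (2 ^ N * (V - (g : ℂ) / 2 ^ N)).re = 2 ^ N * V - g.re := by
    rw [mul_sub, mul_div_cancel₀ _ (pow_ne_zero N (two_ne_zero' ℂ)), Complex.sub_re]
    norm_cast
    simp
  calc |2 ^ N * V - g.re| ≤ ‖2 ^ N * (V - (g : ℂ) / 2 ^ N)‖ := hre ▸ Complex.abs_re_le_norm _
    _ = 2 ^ N * ‖(V : ℂ) - (g : ℂ) / 2 ^ N‖ := by simp
    _ ≤ 2 ^ N * ((2 ^ N)⁻¹ / 2 + (2 ^ N)⁻¹) := by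
      gcongr
      refine (norm_sub_le_norm_sub_add_norm_sub _ z _).trans (add_le_add ?_ hg)
      rwa [norm_sub_rev]
    _ < 2 := by
      field_simp
      norm_num

/-- The exponent `D` of the coefficients `2 ^ (-D m)`. -/
def coeffExp (p : Polynomial ℕ) : Polynomial ℕ :=
  32 * (Polynomial.X + 1) * (p + Polynomial.X + 1)

/-- The exponent `L = D (D + 1)` of `2` in the frequencies. -/
def freqExp (p : Polynomial ℕ) : Polynomial ℕ := coeffExp p * (coeffExp p + 1)

/-- A bound for the binary length of the frequencies. -/
def freqLength (p : Polynomial ℕ) : Polynomial ℕ := freqExp p + Polynomial.X + p + 4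

section Exponents

variable (p : Polynomial ℕ)

theorem le_coeffExp (m : ℕ) : 32 * (p.eval m + m + 1) ≤ (coeffExp p).eval m := by
  simp only [coeffExp, Polynomial.eval_mul, Polynomial.eval_add, Polynomial.eval_X,
    Polynomial.eval_one, Polynomial.eval_ofNat]
  nlinarith [Nat.zero_le (m * (p.eval m + m + 1))]

theorem coeffExp_add_le {m m' : ℕ} (h : m' < m) :
    (coeffExp p).eval m' + 32 * (p.eval m + m + 1) ≤ (coeffExp p).eval m := by
  have hp : p.eval m' ≤ p.eval m := eval_mono p h.le
  simp only [coeffExp, Polynomial.eval_mul, Polynomial.eval_add, Polynomial.eval_X,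
    Polynomial.eval_one, Polynomial.eval_ofNat]
  calc 32 * (m' + 1) * (p.eval m' + m' + 1) + 32 * (p.eval m + m + 1)
      ≤ 32 * (m' + 1) * (p.eval m + m + 1) + 32 * (p.eval m + m + 1) := by gcongr
    _ = 32 * (m' + 1 + 1) * (p.eval m + m + 1) := by ring
    _ ≤ 32 * (m + 1) * (p.eval m + m + 1) := by gcongr; exact h

theorem freqExp_eval (m : ℕ) :
    (freqExp p).eval m = (coeffExp p).eval m * ((coeffExp p).eval m + 1) := by
  simp [freqExp]

theorem freqLength_add_le (m : ℕ) :
    (freqLength p).eval m + 3 + ((coeffExp p).eval m + 2)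
      ≤ ((coeffExp p).eval m + 1) ^ 2 + ((coeffExp p).eval m + 1) := by
  have h := le_coeffExp p m
  simp only [freqLength, Polynomial.eval_add, Polynomial.eval_X, Polynomial.eval_ofNat,
    freqExp_eval]
  nlinarith

theorem le_freqExp_of_lt {m m' : ℕ} (h : m < m') :
    ((coeffExp p).eval m + 1) ^ 2 + ((coeffExp p).eval m + 1) ≤ (freqExp p).eval m' := by
  have hD := coeffExp_add_le p h
  rw [freqExp_eval]
  nlinarith

end Exponents

/-- The number of words accepted by `χ`, whose length is bounded by `p`. -/
def countWords (χ : List Bool → Bool) (p : Polynomial ℕ) (m : ℕ) : ℕ :=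
  Set.ncard {w : List Bool | w.length ≤ p.eval m ∧ χ (unaryPair m w) = true}

variable (χ : List Bool → Bool) (p : Polynomial ℕ)

theorem countWords_lt (m : ℕ) : countWords χ p m < 2 ^ (p.eval m + 2) :=
  (ncard_le_of_length_le fun _ hw => hw.1).trans_lt (Nat.pow_lt_pow_succ one_lt_two)

theorem finite_words (m : ℕ) : (words χ p m).Finite :=
  (List.finite_length_le Bool (p.eval m + 1)).subset fun _ h => h.1

instance (m : ℕ) : Finite (words χ p m) := (finite_words χ p m).to_subtype

theorem ncard_words (m : ℕ) : (words χ p m).ncard = 2 * countWords χ p m + 1 := by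
  set W := {w : List Bool | w.length ≤ p.eval m ∧ χ (unaryPair m w) = true} with hW
  have hfin : W.Finite := (List.finite_length_le Bool (p.eval m)).subset fun _ h => h.1
  have hwords : words χ p m = insert [] (List.cons true '' W ∪ List.cons false '' W) := by
    ext w
    rcases w with _ | ⟨b, w⟩
    · simp [words]
    · cases b <;> simp [words, hW]
  have hdisj : Disjoint (List.cons true '' W) (List.cons false '' W) := by
    rw [Set.disjoint_left]
    rintro _ ⟨_, _, rfl⟩ ⟨_, _, h⟩
    simp at h
  rw [hwords, Set.ncard_insert_of_notMem (by simp) ((hfin.image _).union (hfin.image _)),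
    Set.ncard_union_eq hdisj (hfin.image _) (hfin.image _),
    Set.ncard_image_of_injective _ List.cons_injective,
    Set.ncard_image_of_injective _ List.cons_injective, ← two_mul, countWords]

/-- The terms of the Fourier series of the witness: the words of all the sets `words χ p m`. -/
abbrev Index : Type := Σ m, words χ p m

variable {χ p}

/-- The Fourier coefficient of the witness belonging to a word. -/
def coeff (i : Index χ p) : ℂ := (2 ^ (coeffExp p).eval i.1)⁻¹

/-- The frequency of the witness belonging to a word. -/
def frequency (i : Index χ p) : ℤ := freq (freqExp p) i.1 i.2

/-- Positive weights on the words, of total mass at most one. -/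
def weight (i : Index χ p) : ℝ := (2 ^ (p.eval i.1 + i.1 + 3))⁻¹

theorem weight_nonneg (i : Index χ p) : 0 ≤ weight i := by
  unfold weight
  positivity

theorem frequency_injective : Function.Injective (frequency (χ := χ) (p := p)) := by
  rintro ⟨m, w, hw⟩ ⟨m', w', hw'⟩ h
  obtain ⟨rfl, rfl⟩ := freq_injective (Nat.cast_injective h)
  rfl

theorem abs_frequency_le (i : Index χ p) {m : ℕ} (h : i.1 ≤ m) :
    |frequency i| ≤ 2 ^ (freqLength p).eval m := by
  have hlen : i.2.1.length ≤ p.eval i.1 + 1 := i.2.2.1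
  have hlt := freq_lt (freqExp p) i.1 i.2
  have hexp : (freqExp p).eval i.1 + i.1 + i.2.1.length + 3 ≤ (freqLength p).eval i.1 := by
    simp only [freqLength, Polynomial.eval_add, Polynomial.eval_X, Polynomial.eval_ofNat]
    lia
  have hle := hlt.le.trans (Nat.pow_le_pow_right two_pos (hexp.trans (eval_mono _ h)))
  rw [frequency, Nat.abs_cast]
  exact_mod_cast hle

theorem norm_coeff (i : Index χ p) : ‖coeff i‖ = (2 ^ (coeffExp p).eval i.1)⁻¹ := by
  simp [coeff]

theorem norm_coeff_le (i : Index χ p) : ‖coeff i‖ ≤ (2 ^ i.1 : ℝ)⁻¹ * weight i := by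
  rw [norm_coeff, weight, ← mul_inv, ← pow_add]
  have h := le_coeffExp p i.1
  gcongr
  · exact one_le_two
  · lia

theorem ncard_words_mul_weight_le (m : ℕ) :
    Nat.card (words χ p m) * ((2 : ℝ) ^ (p.eval m + m + 3))⁻¹ ≤ 1 / 2 / 2 ^ m := by
  have hcard : (Nat.card (words χ p m) : ℝ) ≤ 2 ^ (p.eval m + 2) := by
    exact_mod_cast ncard_le_of_length_le fun w (hw : w ∈ words χ p m) => hw.1
  calc Nat.card (words χ p m) * ((2 : ℝ) ^ (p.eval m + m + 3))⁻¹
      ≤ 2 ^ (p.eval m + 2) * (2 ^ (p.eval m + m + 3))⁻¹ := by gcongr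
    _ = 1 / 2 / 2 ^ m := by
      rw [show p.eval m + m + 3 = p.eval m + 2 + (1 + m) by ring, pow_add _ _ (1 + m),
        pow_add _ 1 m]
      field_simp

theorem hasSum_weight : ∃ C ≤ 1, HasSum (weight (χ := χ) (p := p)) C := by
  have hgeom := hasSum_geometric_two' 1
  have hsum : Summable fun m => Nat.card (words χ p m) * ((2 : ℝ) ^ (p.eval m + m + 3))⁻¹ :=
    .of_nonneg_of_le (fun m => by positivity) ncard_words_mul_weight_le hgeom.summable
  exact ⟨_, hasSum_le ncard_words_mul_weight_le hsum.hasSum hgeom,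
    hasSum_sigma_fst (fun m => by positivity) hsum.hasSum⟩

theorem summable_weight : Summable (weight (χ := χ) (p := p)) :=
  let ⟨_, _, h⟩ := hasSum_weight
  h.summable

theorem tsum_weight_le_one : ∑' i : Index χ p, weight i ≤ 1 := by
  obtain ⟨C, hC, h⟩ := hasSum_weight (χ := χ) (p := p)
  rwa [h.tsum_eq]

theorem norm_coeff_le_weight (i : Index χ p) : ‖coeff i‖ ≤ weight i :=
  (norm_coeff_le i).trans <| mul_le_of_le_one_left (weight_nonneg i) <|
    inv_le_one_of_one_le₀ <| one_le_pow₀ one_le_two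

theorem summable_norm_coeff : Summable fun i : Index χ p => ‖coeff i‖ :=
  .of_nonneg_of_le (fun _ => norm_nonneg _) norm_coeff_le_weight summable_weight

theorem tsum_norm_coeff_le_one : ∑' i : Index χ p, ‖coeff i‖ ≤ 1 :=
  (summable_norm_coeff.tsum_le_tsum norm_coeff_le_weight summable_weight).trans tsum_weight_le_one

variable (χ p)

/-- The function with the Fourier coefficients `2 ^ (-D m)` at the frequencies belonging to `m`. -/
def witness : L2Unit :=
  (exists_ae_eq_trigSeries (summable_norm_coeff (χ := χ) (p := p)) frequency).choose

theorem witness_ae_eq :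
    witness χ p =ᵐ[unitMeasure] trigSeries (coeff (χ := χ) (p := p)) frequency :=
  (exists_ae_eq_trigSeries summable_norm_coeff frequency).choose_spec

theorem norm_fourierCoeff_sub_coeffApprox_le (k : ℤ) (n : ℕ) :
    ‖fourierCoeff (witness χ p) k -
      (coeffApprox χ p (freqExp p) (coeffExp p) (n, k) : ℂ) / 2 ^ n‖ ≤ (2 ^ n : ℝ)⁻¹ := by
  by_cases hk : IsFreq χ p (freqExp p) k
  · obtain ⟨m, w, hw, rfl⟩ := hk
    have hcoeff : fourierCoeff (witness χ p) (freq (freqExp p) m w) =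
        (2 ^ (coeffExp p).eval m)⁻¹ :=
      fourierCoeff_apply summable_norm_coeff (witness_ae_eq χ p) frequency_injective ⟨m, w, hw⟩
    rw [hcoeff, coeffApprox, freqIndex_freq]
    rcases le_or_gt ((coeffExp p).eval m) n with h | h
    · obtain ⟨d, rfl⟩ := Nat.exists_eq_add_of_le h
      rw [if_pos ⟨⟨m, w, hw, rfl⟩, h⟩, Nat.add_sub_cancel_left, pow_add]
      push_cast
      field_simp
      simp
    · rw [if_neg fun h' => h.not_ge h'.2, Int.cast_zero, zero_div, sub_zero, norm_inv, norm_pow,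
        Complex.norm_two]
      gcongr
      exact one_le_two
  · have hrange : k ∉ Set.range (frequency (χ := χ) (p := p)) := by
      rintro ⟨⟨m, w, hw⟩, rfl⟩
      exact hk ⟨m, w, hw, rfl⟩
    rw [fourierCoeff_eq_zero summable_norm_coeff (witness_ae_eq χ p) hrange, coeffApprox,
      if_neg fun h => hk h.1]
    simp

theorem eLpNorm_witness_sub_fourierPartialSum_le (m : ℕ) :
    eLpNorm (fun t => witness χ p t - fourierPartialSum (witness χ p) (2 ^ (freqLength p).eval m) t)
      2 unitMeasure ≤ ENNReal.ofReal (2 ^ m : ℝ)⁻¹ := by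
  refine (eLpNorm_sub_fourierPartialSum_le summable_norm_coeff (witness_ae_eq χ p)
    (b := fun i => (2 ^ m : ℝ)⁻¹ * weight i) (summable_weight.mul_left _)
    (fun i => mul_nonneg (by positivity) (weight_nonneg i)) fun i hi => ?_).trans ?_
  · have hm : m < i.1 := by
      by_contra! h
      exact hi.not_ge (by exact_mod_cast abs_frequency_le i h)
    refine (norm_coeff_le i).trans (mul_le_mul_of_nonneg_right ?_ (weight_nonneg i))
    gcongr
    exact one_le_two
  · rw [tsum_mul_left]
    exact ENNReal.ofReal_le_ofReal (mul_le_of_le_one_right (by positivity) tsum_weight_le_one)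

variable {χ} in
theorem fourierPolyTime_witness (hχ : PolyTime id encodeBool χ) :
    FourierPolyTime (witness χ p) := by
  refine ⟨⟨fun k n => ⟨coeffApprox χ p (freqExp p) (coeffExp p) (n, k), 0⟩, fun k n => ?_,
    polyTime_coeffApprox hχ p _ _, polyTime_const _ _ 0⟩,
    freqLength p, eLpNorm_witness_sub_fourierPartialSum_le χ p⟩
  simpa [GaussianInt.toComplex_def] using norm_fourierCoeff_sub_coeffApprox_le χ p k n

/-- The sum of the coefficients belonging to the numbers `0, …, m`. -/
def coeffSum (m : ℕ) : ℝ :=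
  ∑ i ∈ Finset.range (m + 1), Nat.card (words χ p i) * (2 ^ (coeffExp p).eval i)⁻¹

theorem hasSum_indicator_norm_coeff (m : ℕ) :
    HasSum (Set.indicator {i : Index χ p | i.1 ≤ m} fun i => ‖coeff i‖) (coeffSum χ p m) := by
  let c (i : ℕ) : ℝ := if i ≤ m then (2 ^ (coeffExp p).eval i)⁻¹ else 0
  have hsum : HasSum (fun i => Nat.card (words χ p i) * c i) (coeffSum χ p m) := by
    have hcoeffSum : coeffSum χ p m =
        ∑ i ∈ Finset.range (m + 1), Nat.card (words χ p i) * c i :=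
      Finset.sum_congr rfl fun i hi => by
        rw [show c i = _ from if_pos (Finset.mem_range_succ_iff.1 hi)]
    rw [hcoeffSum]
    refine hasSum_sum_of_ne_finset_zero fun i hi => ?_
    rw [show c i = 0 from if_neg (mt Finset.mem_range_succ_iff.2 hi), mul_zero]
  have hc₀ (i : ℕ) : 0 ≤ c i := by positivity
  convert! hasSum_sigma_fst hc₀ hsum using 2 with i
  simp only [Set.indicator_apply, Set.mem_ofPred_eq, norm_coeff, c]

theorem coeffSum_le_one (m : ℕ) : coeffSum χ p m ≤ 1 :=
  (hasSum_le (Set.indicator_le_self' fun _ _ => norm_nonneg _)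
    (hasSum_indicator_norm_coeff χ p m) summable_norm_coeff.hasSum).trans tsum_norm_coeff_le_one

theorem hasSum_indicator_coeff (m : ℕ) :
    HasSum (Set.indicator {i : Index χ p | i.1 ≤ m} coeff) (coeffSum χ p m : ℂ) := by
  convert! Complex.hasSum_ofReal.2 (hasSum_indicator_norm_coeff χ p m) using 2 with i
  rw [Set.indicator_apply, Set.indicator_apply]
  split_ifs
  · simp [coeff]
  · rfl

theorem norm_stepAverage_witness_sub_le {m N : ℕ} (hN : N = (coeffExp p).eval m + 1) :
    ‖stepAverage (witness χ p) (2 ^ (N ^ 2 + N)) 0 - coeffSum χ p m‖ ≤ (2 ^ N : ℝ)⁻¹ / 2 := by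
  have hlow : ∀ i ∈ {i : Index χ p | i.1 ≤ m},
      2 * Real.pi * |frequency i| / (2 ^ (N ^ 2 + N) : ℕ) ≤ (2 ^ N : ℝ)⁻¹ / 2 := by
    intro i hi
    have hfreq : (|frequency i| : ℝ) ≤ 2 ^ (freqLength p).eval m := by
      exact_mod_cast abs_frequency_le i hi
    have hpi : 2 * Real.pi ≤ 2 ^ 3 := by linarith [Real.pi_le_four]
    have hexp : (freqLength p).eval m + 3 + (N + 1) ≤ N ^ 2 + N := hN ▸ freqLength_add_le p m
    push_cast
    rw [div_le_div_iff₀ (by positivity) two_pos, ← div_eq_inv_mul, le_div_iff₀ (by positivity)]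
    calc 2 * Real.pi * |(frequency i : ℝ)| * 2 * 2 ^ N
        ≤ 2 ^ 3 * 2 ^ (freqLength p).eval m * 2 * 2 ^ N := by gcongr
      _ = 2 ^ ((freqLength p).eval m + 3 + (N + 1)) := by ring
      _ ≤ 2 ^ (N ^ 2 + N) := pow_le_pow_right₀ one_le_two hexp
  have hhigh : ∀ i ∉ {i : Index χ p | i.1 ≤ m},
      frequency i ≠ 0 ∧ ((2 ^ (N ^ 2 + N) : ℕ) : ℤ) ∣ frequency i := by
    intro i hi
    have hexp : N ^ 2 + N ≤ (freqExp p).eval i.1 := hN ▸ le_freqExp_of_lt p (not_le.1 hi)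
    exact ⟨Nat.cast_ne_zero.2 (freq_ne_zero _ _ _),
      Int.natCast_dvd_natCast.2 ((pow_dvd_pow 2 hexp).trans (two_pow_dvd_freq _ _ _))⟩
  refine (norm_stepAverage_sub_le summable_norm_coeff (witness_ae_eq χ p) (by positivity) hlow
    (by positivity) hhigh (hasSum_indicator_coeff χ p m)).trans ?_
  exact mul_le_of_le_one_right (by positivity) tsum_norm_coeff_le_one

theorem exists_two_pow_mul_coeffSum_eq (m : ℕ) : ∃ x : ℕ,
    (2 : ℝ) ^ ((coeffExp p).eval m + 1) * coeffSum χ p m = 4 * x + 2 ∧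
      x % 2 ^ (p.eval m + 2) = countWords χ p m := by
  have hblock : ∀ i ∈ Finset.range m, ∃ z : ℕ, (2 : ℝ) ^ ((coeffExp p).eval m + 1) *
      (Nat.card (words χ p i) * (2 ^ (coeffExp p).eval i)⁻¹) =
        4 * 2 ^ (p.eval m + 2) * z := by
    intro i hi
    have hD := coeffExp_add_le p (Finset.mem_range.1 hi)
    obtain ⟨d, hd⟩ : ∃ d, (coeffExp p).eval m = (coeffExp p).eval i + (p.eval m + 3) + d :=
      Nat.exists_eq_add_of_le (by lia)
    refine ⟨2 ^ d * Nat.card (words χ p i), ?_⟩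
    rw [hd]
    push_cast
    field_simp
    ring
  choose! z hz using hblock
  refine ⟨countWords χ p m + 2 ^ (p.eval m + 2) * ∑ i ∈ Finset.range m, z i, ?_, ?_⟩
  · rw [coeffSum, Finset.mul_sum, Finset.sum_range_succ, Finset.sum_congr rfl hz,
      ← Finset.mul_sum, Nat.card_coe_set_eq, ncard_words]
    push_cast
    rw [pow_succ]
    field_simp
    ring
  · rw [Nat.add_mul_mod_self_left, Nat.mod_eq_of_lt (countWords_lt χ p m)]

variable {χ p} in
theorem countWords_mem_classFP1
    (h : FirstStepPolyTime (witness χ p) fun n => 2 ^ (n ^ 2 + n)) :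
    countWords χ p ∈ classFP1 := by
  obtain ⟨g, hg, hre, -⟩ := h
  choose x hx hcount using exists_two_pow_mul_coeffSum_eq χ p
  have hread (m : ℕ) := natAbs_div_four_eq <| hx m ▸
    abs_two_pow_mul_sub_re_lt (norm_stepAverage_witness_sub_le χ p rfl) (hg _)
  have hbound (m : ℕ) : (g ((coeffExp p + 1).eval m)).re.natAbs < 2 ^ (coeffExp p + 2).eval m := by
    have hle : 4 * x m + 2 ≤ 2 ^ ((coeffExp p).eval m + 1) := by
      have hle := mul_le_of_le_one_right (by positivity) (coeffSum_le_one χ p m)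
        (a := (2 : ℝ) ^ ((coeffExp p).eval m + 1))
      rw [hx m] at hle
      exact_mod_cast hle
    have hlt := (hread m).2
    simp only [Polynomial.eval_add, Polynomial.eval_one, Polynomial.eval_ofNat, pow_succ] at *
    lia
  have hbits := polyTime_extractBits hre (coeffExp p + 1) 2 (p + 2) _ hbound
  convert! hbits using 1
  funext m
  simp only [Polynomial.eval_add, Polynomial.eval_one, Polynomial.eval_ofNat]
  rw [← hcount, ← (hread m).1]
  rfl

theorem classSharpP1_nonempty : classSharpP1.Nonempty :=
  ⟨_, ∅, ⟨fun _ => false, by simp, polyTime_const _ _ _⟩, 0, fun _ => rfl⟩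

theorem exists_fourierPolyTime_of_mem_classSharpP1 {φ : ℕ → ℕ} (hφ : φ ∈ classSharpP1) :
    ∃ f : L2Unit, FourierPolyTime f ∧
      (FirstStepPolyTime f (fun n => 2 ^ (n ^ 2 + n)) → φ ∈ classFP1) := by
  obtain ⟨P, ⟨χ, hP, hχ⟩, p, hp⟩ := hφ
  have hcount : φ = countWords χ p := funext fun m => by simp only [hp, countWords, hP]
  exact ⟨witness χ p, fourierPolyTime_witness p hχ, fun h => hcount ▸ countWords_mem_classFP1 h⟩

end FourierStep

end

theorem theoremt :
    ∃ f : FourierStep.L2Unit,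
      FourierStep.FourierPolyTime f ∧
      (¬ FourierStep.classSharpP1 ⊆ FourierStep.classFP1 →
        ¬ FourierStep.FirstStepPolyTime f (fun n => 2 ^ (n ^ 2 + n))) := by
  have hhard : ∃ φ ∈ FourierStep.classSharpP1,
      ¬ FourierStep.classSharpP1 ⊆ FourierStep.classFP1 → φ ∉ FourierStep.classFP1 := by
    by_cases hsub : FourierStep.classSharpP1 ⊆ FourierStep.classFP1
    · exact FourierStep.classSharpP1_nonempty.imp fun φ hφ => ⟨hφ, fun h => absurd hsub h⟩
    · obtain ⟨φ, hφ, hφ'⟩ := Set.not_subset.1 hsub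
      exact ⟨φ, hφ, fun _ => hφ'⟩
  obtain ⟨φ, hφ, hφ'⟩ := hhard
  obtain ⟨f, hf, hstep⟩ := FourierStep.exists_fourierPolyTime_of_mem_classSharpP1 hφ
  exact ⟨f, hf, fun hsub h => hφ' hsub (hstep h)⟩
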